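/- Let $\Bbbk$ be a commutative ring with unit, $n\ge 0$, and let $\mathrm{OPol}_n=\Bbbk\langle x_1,\dots,x_n\rangle/(x_ix_j+x_jx_i=0\text{ for }i\neq j)$ be the superalgebra of skew polynomials, with all $x_i$ odd; $p(f)$ denotes the parity of a homogeneous $f$. Let $d:\mathrm{OPol}_n\to\mathrm{OPol}_n$ be the $\Bbbk$-linear differential with $d(x_i)=x_i^2$ and $d(fg)=d(f)g+(-1)^{p(f)}f\,d(g)$. Let $\mathrm{O\Lambda}_n\subseteq\mathrm{OPol}_n$ be the subalgebra generated by the untwisted odd elementary symmetric polynomials $e_r=\sum_{i_1<\dots<i_r}x_{i_1}\cdots x_{i_r}$. Let $\theta$ and $w_0$ be the algebra endomorphisms of $\mathrm{OPol}_n$ with $\theta(x_i)=(-1)^{i-1}x_i=:\widetilde x_i$ and $w_0(x_i)=x_{n+1-i}$. For $1\le i\le n-1$ let $s_i$ be the algebra automorphism exchanging $x_i$ and $x_{i+1}$ and fixing the other variables, and let $\partial_i$ be the odd divided difference operator: the $\Bbbk$-linear map with $\partial_i(x_j)=1$ for $j\in\{i,i+1\}$, $\partial_i(x_j)=0$ for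 other $j$, and $\partial_i(fg)=\partial_i(f)g+(-1)^{p(f)}s_i(f)\partial_i(g)$. Put $\partial_{w_0}=\partial_1(\partial_2\partial_1)\cdots(\partial_{n-1}\cdots\partial_1)$ and $\delta=(n-1,n-2,\dots,1,0)$, and $\widetilde x^{a}=\widetilde x_1^{a_1}\cdots\widetilde x_n^{a_n}$ for $a\in\mathbb Z_{\ge0}^n$. For a partition $\lambda=(\lambda_1\ge\dots\ge\lambda_n\ge0)$ of length at most $n$, the untwisted odd Schur polynomial is $$s_\lambda=w_0\,\theta\,\partial_{w_0}(\widetilde x^\delta\widetilde x^\lambda).$$ Then $s_\lambda\in\mathrm{O\Lambda}_n$, and $$d(s_\lambda)=\sum_{\mu}(-1)^{\lvert\lambda/i\rvert+i-1}\{\mathrm{ct}(\mu\setminus\lambda)\}\,s_\mu,$$ where the sum is over all partitions $\mu$ of length at most $n$ obtained from $\lambda$ by adding one box, $i$ denotes the row of the added box, $\lvert\lambda/i\rvert=\lambda_1+\dots+\lambda_{i-1}$ is the size of $\lambda$ with rows $i$ and below removed, $\mathrm{ct}(\mu\setminus\lambda)=(\lambda_i+1)-i$ is the content (column number minus row number)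 of the added box, and $\{m\}$ is $0$ for even $m$ and $1$ for odd $m$. In particular, only boxes of odd content contribute. -/

import Mathlib

open Finset

noncomputable section

/-- The defining relations of skew polynomials: `x_i x_j = -x_j x_i` for `i ≠ j`. -/
inductive OPolRel (k : Type*) [CommRing k] (n : ℕ) :
    FreeAlgebra k (Fin n) → FreeAlgebra k (Fin n) → Prop
  | anticomm (i j : Fin n) (hij : i ≠ j) :
      OPolRel k n (FreeAlgebra.ι k i * FreeAlgebra.ι k j + FreeAlgebra.ι k j * FreeAlgebra.ι k i) 0

/-- The algebra of skew (odd) polynomials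
`OPol_n = k⟨x_1, …, x_n⟩ / (x_i x_j + x_j x_i = 0 for i ≠ j)`. -/
def OPol (k : Type*) [CommRing k] (n : ℕ) : Type _ := RingQuot (OPolRel k n)

namespace OPol

variable {k : Type*} [CommRing k] {n : ℕ}

instance : Ring (OPol k n) := inferInstanceAs (Ring (RingQuot (OPolRel k n)))
instance : Algebra k (OPol k n) := inferInstanceAs (Algebra k (RingQuot (OPolRel k n)))

/-- The generators. Indices are shifted by one: `x i` with `i : Fin n` is the variable `x_{i+1}`. -/
def x (i : Fin n) : OPol k n := RingQuot.mkAlgHom k (OPolRel k n) (FreeAlgebra.ι k i)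

theorem x_anticomm {i j : Fin n} (hij : i ≠ j) :
    (x i * x j + x j * x i : OPol k n) = 0 := by
  have h := RingQuot.mkAlgHom_rel k (OPolRel.anticomm (k := k) i j hij)
  rw [map_add, map_mul, map_mul, map_zero] at h
  exact h

/-- The universal property of `OPol_n`. -/
def lift {A : Type*} [Ring A] [Algebra k A] (v : Fin n → A)
    (hv : ∀ i j, i ≠ j → v i * v j + v j * v i = 0) : OPol k n →ₐ[k] A :=
  RingQuot.liftAlgHom k ⟨FreeAlgebra.lift k v, by
    rintro _ _ ⟨i, j, hij⟩
    simpa using hv i j hij⟩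

@[simp] theorem lift_x {A : Type*} [Ring A] [Algebra k A] (v : Fin n → A)
    (hv : ∀ i j, i ≠ j → v i * v j + v j * v i = 0) (i : Fin n) :
    lift (k := k) v hv (x i) = v i := by
  have h := RingQuot.liftAlgHom_mkAlgHom_apply (S := k) (FreeAlgebra.lift k v)
    (s := OPolRel k n) (by rintro _ _ ⟨i, j, hij⟩; simpa using hv i j hij) (FreeAlgebra.ι k i)
  rw [FreeAlgebra.lift_ι_apply] at h
  exact h

@[ext] theorem hom_ext {A : Type*} [Ring A] [Algebra k A] {f g : OPol k n →ₐ[k] A}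
    (h : ∀ i, f (x i) = g (x i)) : f = g :=
  RingQuot.ringQuot_ext' k f g (FreeAlgebra.hom_ext (funext h))

/-- The algebra endomorphism `x_i ↦ c_i x_{σ(i)}` for a permutation `σ` and scalars `c_i`. -/
def monomialHom (σ : Equiv.Perm (Fin n)) (c : Fin n → k) : OPol k n →ₐ[k] OPol k n :=
  lift (fun i => c i • x (σ i)) (by
    intro i j hij
    have h := x_anticomm (k := k) (σ.injective.ne hij)
    simp only [smul_mul_assoc, mul_smul_comm]
    rw [smul_comm (c j) (c i), ← smul_add, ← smul_add, h, smul_zero, smul_zero])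

@[simp] theorem monomialHom_x (σ : Equiv.Perm (Fin n)) (c : Fin n → k) (i : Fin n) :
    monomialHom σ c (x i) = c i • x (σ i) := lift_x _ _ i

/-- The parity involution `ι`: the generators are odd, so `ι f = (-1)^{p(f)} f`
for parity homogeneous `f`. -/
def parity : OPol k n →ₐ[k] OPol k n := monomialHom 1 fun _ => -1

/-- The action of a permutation `w`: `w(x_j) = x_{w(j)}`. -/
def permAct (w : Equiv.Perm (Fin n)) : OPol k n →ₐ[k] OPol k n := monomialHom w fun _ => 1

/-- The action of the longest element `w_0 : j ↦ n + 1 - j` of the symmetric group. -/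
def w0 : OPol k n →ₐ[k] OPol k n := permAct Fin.revPerm

/-- The twisting involution `θ : x_i ↦ (-1)^{i-1} x_i` (here with zero-based indices). -/
def theta : OPol k n →ₐ[k] OPol k n := monomialHom 1 fun i => (-1) ^ (i : ℕ)

/-- Auxiliary homomorphism `f ↦ !![σ f, D f; 0, f]`, which encodes a `σ`-derivation `D`. -/
def skewDerHom (σ : OPol k n →ₐ[k] OPol k n) (v : Fin n → OPol k n)
    (hv : ∀ i j, i ≠ j → v i * x j + σ (x i) * v j + (v j * x i + σ (x j) * v i) = 0) :
    OPol k n →ₐ[k] Matrix (Fin 2) (Fin 2) (OPol k n) :=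
  lift (fun i => !![σ (x i), v i; 0, x i]) (by
    intro i j hij
    have h1 := x_anticomm (k := k) hij
    have h2 := congrArg σ h1
    rw [map_add, map_mul, map_mul, map_zero] at h2
    have h3 := hv i j hij
    rw [add_comm (v i * x j), add_comm (v j * x i)] at h3
    ext a b
    fin_cases a <;> fin_cases b <;> simp [h1, h2, h3])

/-- The unique `k`-linear `D` with `D(x_i) = v_i`, `D(fg) = D(f) g + σ(f) D(g)`. -/
def skewDer (σ : OPol k n →ₐ[k] OPol k n) (v : Fin n → OPol k n)
    (hv : ∀ i j, i ≠ j → v i * x j + σ (x i) * v j + (v j * x i + σ (x j) * v i) = 0) :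
    OPol k n →ₗ[k] OPol k n where
  toFun f := skewDerHom σ v hv f 0 1
  map_add' f g := by simp
  map_smul' c f := by simp

section skewDer

variable (σ : OPol k n →ₐ[k] OPol k n) (v : Fin n → OPol k n)
  (hv : ∀ i j, i ≠ j → v i * x j + σ (x i) * v j + (v j * x i + σ (x j) * v i) = 0)

/-- Induction along the generators. -/
theorem induction_on {P : OPol k n → Prop} (f : OPol k n)
    (hc : ∀ c, P (algebraMap k _ c)) (hx : ∀ i, P (x i))
    (hmul : ∀ f g, P f → P g → P (f * g)) (hadd : ∀ f g, P f → P g → P (f + g)) : P f := by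
  obtain ⟨p, rfl⟩ := RingQuot.mkAlgHom_surjective k (OPolRel k n) f
  induction p using FreeAlgebra.induction with
  | grade0 c => rw [AlgHom.commutes]; exact hc c
  | grade1 i => exact hx i
  | mul a b ha hb => rw [map_mul]; exact hmul _ _ ha hb
  | add a b ha hb => rw [map_add]; exact hadd _ _ ha hb

theorem skewDerHom_apply (f : OPol k n) :
    skewDerHom σ v hv f = !![σ f, skewDer σ v hv f; 0, f] := by
  have key : skewDerHom σ v hv f 0 0 = σ f ∧ skewDerHom σ v hv f 1 0 = 0 ∧
      skewDerHom σ v hv f 1 1 = f := by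
    induction f using induction_on with
    | hc c =>
      simp only [AlgHom.commutes, Matrix.algebraMap_matrix_apply]
      simp
    | hx i => simp [skewDerHom]
    | hmul f g hf hg =>
      simp only [map_mul, Matrix.mul_apply, Fin.sum_univ_two, hf, hg]
      simp
    | hadd f g hf hg =>
      simp only [map_add, Matrix.add_apply, hf, hg]
      simp
  obtain ⟨h00, h10, h11⟩ := key
  ext a b
  fin_cases a <;> fin_cases b
  · exact h00
  · rfl
  · exact h10
  · exact h11

@[simp] theorem skewDer_x (i : Fin n) : skewDer σ v hv (x i) = v i := by
  change skewDerHom σ v hv (x i) 0 1 = v i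
  simp [skewDerHom]

@[simp] theorem skewDer_one : skewDer σ v hv 1 = 0 := by
  change skewDerHom σ v hv 1 0 1 = 0
  simp

theorem skewDer_mul (f g : OPol k n) :
    skewDer σ v hv (f * g) = skewDer σ v hv f * g + σ f * skewDer σ v hv g := by
  change skewDerHom σ v hv (f * g) 0 1 = _
  rw [map_mul, skewDerHom_apply, skewDerHom_apply]
  simp [Matrix.mul_apply, add_comm]

end skewDer

/-- The differential `d` of the dg algebra `OPol_n`: the odd derivation with `d(x_i) = x_i²`,
i.e. `d(fg) = d(f) g + (-1)^{p(f)} f d(g)`. -/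
def d : OPol k n →ₗ[k] OPol k n :=
  skewDer parity (fun i => x i ^ 2) (by
    intro i j hij
    have h : (x i * x j : OPol k n) = -(x j * x i) := eq_neg_of_add_eq_zero_left (x_anticomm hij)
    have h1 : (x i ^ 2 * x j : OPol k n) = x j * x i ^ 2 := by
      rw [pow_two, mul_assoc, h, mul_neg, ← mul_assoc, h, neg_mul, neg_neg, mul_assoc]
    have h2 : (x i * x j ^ 2 : OPol k n) = x j ^ 2 * x i := by
      rw [pow_two, ← mul_assoc, h, neg_mul, mul_assoc, h, mul_neg, neg_neg, mul_assoc]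
    simp only [parity, monomialHom_x, Equiv.Perm.one_apply, neg_smul, one_smul, neg_mul]
    rw [h1, h2]
    abel)

theorem d_x (i : Fin n) : d (x i : OPol k n) = x i ^ 2 := skewDer_x _ _ _ i

theorem d_mul (f g : OPol k n) : d (f * g) = d f * g + parity f * d g := skewDer_mul _ _ _ f g

/-- The odd divided difference operator attached to the transposition of `a ≠ b`: it sends
`x_a, x_b` to `1` and the other variables to `0`, and
`∂(fg) = ∂(f) g + (-1)^{p(f)} s(f) ∂(g)` with `s = (a b)`. -/
def dividedDiffSwap (a b : Fin n) : OPol k n →ₗ[k] OPol k n :=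
  skewDer ((permAct (Equiv.swap a b)).comp parity) (fun j => if j = a ∨ j = b then 1 else 0) (by
    intro i j hij
    simp only [AlgHom.comp_apply, parity, permAct, monomialHom_x, neg_smul, one_smul,
      Equiv.Perm.one_apply]
    by_cases hia : i = a <;> by_cases hib : i = b <;> by_cases hja : j = a <;>
      by_cases hjb : j = b <;> subst_vars <;>
      simp_all [Equiv.swap_apply_of_ne_of_ne])

/-- The `i`-th odd divided difference operator, `1 ≤ i ≤ n - 1`, in zero-based indexing:
`dividedDiff i` is `∂_{i+1}`, which is attached to the variables `x_{i+1}, x_{i+2}`.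
(Outside `i + 1 < n` it is set to `0`; these values are never used.) -/
def dividedDiff (i : ℕ) : OPol k n →ₗ[k] OPol k n :=
  if h : i + 1 < n then dividedDiffSwap ⟨i, Nat.lt_of_succ_lt h⟩ ⟨i + 1, h⟩ else 0

theorem dividedDiff_x {i : ℕ} (hi : i + 1 < n) (j : Fin n) :
    dividedDiff i (x j : OPol k n) = if (j : ℕ) = i ∨ (j : ℕ) = i + 1 then 1 else 0 := by
  rw [dividedDiff, dif_pos hi, dividedDiffSwap, skewDer_x]
  simp only [Fin.ext_iff]

theorem dividedDiff_mul {i : ℕ} (hi : i + 1 < n) (f g : OPol k n) :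
    dividedDiff i (f * g) = dividedDiff i f * g +
      permAct (Equiv.swap ⟨i, Nat.lt_of_succ_lt hi⟩ ⟨i + 1, hi⟩) (parity f) * dividedDiff i g := by
  rw [dividedDiff, dif_pos hi]
  exact skewDer_mul _ _ _ f g

/-- The operator `∂_m ∂_{m-1} ⋯ ∂_1` (one-based indices). -/
def dividedDiffDesc : ℕ → (OPol k n →ₗ[k] OPol k n)
  | 0 => LinearMap.id
  | m + 1 => dividedDiff m ∘ₗ dividedDiffDesc m

/-- The operator `∂_1 (∂_2 ∂_1) ⋯ (∂_{m-1} ⋯ ∂_1)` (one-based indices). -/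
def dividedDiffStair : ℕ → (OPol k n →ₗ[k] OPol k n)
  | 0 => LinearMap.id
  | m + 1 => dividedDiffStair m ∘ₗ dividedDiffDesc m

/-- `∂_{w_0} = ∂_1 (∂_2 ∂_1) ⋯ (∂_{n-1} ⋯ ∂_1)`. -/
def dividedDiffLongest : OPol k n →ₗ[k] OPol k n := dividedDiffStair n

/-- The twisted variables `x̃_i = θ(x_i) = (-1)^{i-1} x_i`. -/
def xTwist (i : Fin n) : OPol k n := theta (x i)

/-- The ordered monomial `x̃^a = x̃_1^{a_1} ⋯ x̃_n^{a_n}`. -/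
def monTwist (a : Fin n → ℕ) : OPol k n := (List.ofFn fun i => xTwist i ^ a i).prod

/-- `δ = (n-1, n-2, …, 1, 0)`. -/
def delta (n : ℕ) (i : Fin n) : ℕ := n - 1 - i

variable (k) in
/-- The untwisted odd Schur polynomial `s_λ = w_0 θ ∂_{w_0} (x̃^δ x̃^λ)` of a tuple
`λ = (λ_1, …, λ_n)`; partitions of length at most `n` are the weakly decreasing tuples. -/
def schur (lam : Fin n → ℕ) : OPol k n :=
  w0 (theta (dividedDiffLongest (monTwist (delta n) * monTwist lam)))

variable (k n) in
/-- The untwisted odd elementary symmetric polynomial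
`e_r = ∑_{i_1 < ⋯ < i_r} x_{i_1} ⋯ x_{i_r}`. -/
def elemSymm (r : ℕ) : OPol k n :=
  ∑ s ∈ powersetCard r (univ : Finset (Fin n)), ((s.sort (· ≤ ·)).map x).prod

variable (k n) in
/-- The algebra `OΛ_n` of untwisted odd symmetric polynomials. -/
def oddSymm : Subalgebra k (OPol k n) := Algebra.adjoin k (Set.range (elemSymm k n))

end OPol

/-- `{m}` is `0` if `m` is even and `1` if `m` is odd. -/
def parityBracket (m : ℤ) : ℤ := if Even m then 0 else 1

/-- The tuple obtained from `lam` by adding one box in row `i`. -/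
def addBox {n : ℕ} (lam : Fin n → ℕ) (i : Fin n) : Fin n → ℕ :=
  Function.update lam i (lam i + 1)

/-- The content (column minus row, one-based) of the box added to `lam` in row `i`. -/
def addedContent {n : ℕ} (lam : Fin n → ℕ) (i : Fin n) : ℤ :=
  ((lam i : ℤ) + 1) - ((i : ℤ) + 1)

/-- The size of `λ` with row `i` and the rows below it removed. -/
def sizeAbove {n : ℕ} (lam : Fin n → ℕ) (i : Fin n) : ℕ := ∑ j ∈ univ.filter (· < i), lam j

end

/-! Put `E = x_1 + ⋯ + x_n`. The relations give `2 d(f) = E f - (-1)^{p(f)} f E` (`two_smul_d`), so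
twice the formula is a statement about multiplying by `E` on both sides. As `w0 ∘ theta` is an
algebra map commuting with parity and carrying `Ẽ = ∑ x̃_i` to `E`, it suffices to multiply
`∂_{w0}(x̃^δ x̃^λ)` by `Ẽ`. On the right, `Ẽ` passes through `∂_{w0}` since every `∂_i` kills it. On
the left it passes up to the sign `(-1)^{n(n-1)/2 + n + 1}`; this is the main computation
(`dividedDiffStair_alternatingSum_mul`), and it rests on `∂_{w0} ∂_i = 0`. Once each `x̃_i` is moved
between `x̃^δ` and `x̃^λ`, the two sides carry signs whose difference is 0 or ±2 according to the
parity of the content. Rows where no box can be added contribute zero, because `δ + μ` then has two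
equal adjacent entries.

The factor 2 is cancelled over the integers, where skew polynomials have no 2-torsion, and the
result is transported to `k` by base change.

For membership, every skew polynomial is a combination of staircase products of the `x̃_i` times
symmetric elements placed on the right. `∂_{w0}` is right linear over the latter, and sends
staircase products, of degree at most `n(n-1)/2`, to scalars. So its image lies in the algebra of
twisted elementary polynomials, whose generators `w0 ∘ theta` sends to `± e_r`. -/

namespace OPol

/-! ### Ordered elementary symmetric polynomials in a noncommutative ring -/

section ListEsymm

variable {R : Type*} [Ring R]

/-- The ordered elementary symmetric polynomial of degree `r` in the entries of a list. -/
def listEsymm : ℕ → List R → R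
  | 0, _ => 1
  | _ + 1, [] => 0
  | r + 1, a :: L => listEsymm (r + 1) L + a * listEsymm r L

@[simp] theorem listEsymm_zero (L : List R) : listEsymm 0 L = 1 := by cases L <;> rfl

@[simp] theorem listEsymm_succ_nil (r : ℕ) : listEsymm (r + 1) ([] : List R) = 0 := rfl

theorem listEsymm_succ_cons (r : ℕ) (a : R) (L : List R) :
    listEsymm (r + 1) (a :: L) = listEsymm (r + 1) L + a * listEsymm r L := rfl

theorem listEsymm_one (L : List R) : listEsymm 1 L = L.sum := by
  induction L with
  | nil => rfl
  | cons a L ih => rw [listEsymm_succ_cons, ih, listEsymm_zero, mul_one, List.sum_cons, add_comm]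

theorem listEsymm_of_length_lt {r : ℕ} {L : List R} (h : L.length < r) : listEsymm r L = 0 := by
  induction L generalizing r with
  | nil => obtain ⟨r, rfl⟩ := Nat.exists_eq_succ_of_ne_zero (Nat.ne_of_gt h); rfl
  | cons a L ih =>
    obtain ⟨r, rfl⟩ := Nat.exists_eq_succ_of_ne_zero (Nat.ne_of_gt (Nat.zero_lt_of_lt h))
    rw [List.length_cons] at h
    rw [listEsymm_succ_cons, ih (by omega), ih (by omega), mul_zero, add_zero]

theorem map_listEsymm {S : Type*} [Ring S] (φ : R →+* S) (r : ℕ) (L : List R) :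
    φ (listEsymm r L) = listEsymm r (L.map φ) := by
  induction L generalizing r with
  | nil => cases r <;> simp
  | cons a L ih => cases r <;> simp [listEsymm_succ_cons, ih]

theorem listEsymm_mem {S : Subring R} {L : List R} (h : ∀ a ∈ L, a ∈ S) (r : ℕ) :
    listEsymm r L ∈ S := by
  induction L generalizing r with
  | nil => cases r <;> simp [S.one_mem, S.zero_mem]
  | cons a L ih =>
    have h' := ih fun b hb => h b (List.mem_cons_of_mem _ hb)
    cases r with
    | zero => simp [S.one_mem]
    | succ r => exact S.add_mem (h' _) (S.mul_mem (h a List.mem_cons_self) (h' r))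

/-- Neighbouring entries `a, b` enter an ordered elementary polynomial only through `a + b` and `a *
b`, as no other factor can stand between them. Used with `S` the kernel of a divided difference. -/
theorem listEsymm_ofFn_mem_of_adjacent {S : Subring R} {m : ℕ} (y : Fin m → R) {i : ℕ}
    (hi : i + 1 < m) (h : ∀ j : Fin m, (j : ℕ) ≠ i → (j : ℕ) ≠ i + 1 → y j ∈ S)
    (hadd : y ⟨i, Nat.lt_of_succ_lt hi⟩ + y ⟨i + 1, hi⟩ ∈ S)
    (hmul : y ⟨i, Nat.lt_of_succ_lt hi⟩ * y ⟨i + 1, hi⟩ ∈ S) (r : ℕ) :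
    listEsymm r (List.ofFn y) ∈ S := by
  induction m generalizing i r with
  | zero => omega
  | succ m ih =>
    rw [List.ofFn_succ]
    cases i with
    | zero =>
      obtain ⟨m, rfl⟩ : ∃ l, m = l + 1 := ⟨m - 1, by omega⟩
      rw [List.ofFn_succ]
      have h' : ∀ r, listEsymm r (List.ofFn fun j : Fin m => y j.succ.succ) ∈ S :=
        listEsymm_mem fun z hz => by
          obtain ⟨j, rfl⟩ := (List.mem_ofFn' _ _).1 hz
          exact h _ (by simp) (by simp)
      generalize (List.ofFn fun j : Fin m => y j.succ.succ) = L at h'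
      generalize hb : y (Fin.succ 0) = b
      generalize ha : y 0 = a
      replace hadd : a + b ∈ S := by rw [← ha, ← hb]; exact hadd
      replace hmul : a * b ∈ S := by rw [← ha, ← hb]; exact hmul
      rcases r with _ | _ | r
      · simp [S.one_mem]
      · have : listEsymm 1 (a :: b :: L) = listEsymm 1 L + (a + b) := by
          simp [listEsymm_succ_cons]; abel
        simpa only [this, zero_add] using S.add_mem (h' 1) hadd
      · have : listEsymm (r + 2) (a :: b :: L) =
            listEsymm (r + 2) L + (a + b) * listEsymm (r + 1) L + a * b * listEsymm r L := by
          simp only [listEsymm_succ_cons]; noncomm_ring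
        rw [this]
        exact S.add_mem (S.add_mem (h' _) (S.mul_mem hadd (h' _))) (S.mul_mem hmul (h' _))
    | succ i =>
      have h' := ih (fun j => y j.succ) (by omega)
        (fun j h1 h2 => h _ (by simpa using h1) (by simpa using h2)) hadd hmul
      cases r with
      | zero => simp [S.one_mem]
      | succ r => exact S.add_mem (h' _) (S.mul_mem (h 0 (by simp) (by simp)) (h' r))

theorem mul_listEsymm_of_anticomm {a : R} {L : List R} (h : ∀ b ∈ L, a * b = -(b * a)) (r : ℕ) :
    a * listEsymm r L = (-1) ^ r * (listEsymm r L * a) := by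
  induction L generalizing r with
  | nil => cases r <;> simp
  | cons b L ih =>
    have h' := ih fun c hc => h c (List.mem_cons_of_mem _ hc)
    cases r with
    | zero => simp
    | succ r =>
      have hb := h b List.mem_cons_self
      have hc : (-1 : R) ^ r * b = b * (-1) ^ r :=
        ((Commute.neg_one_left b).pow_left r).eq
      have hr : a * (b * listEsymm r L) = (-1) ^ (r + 1) * (b * listEsymm r L * a) := by
        rw [← mul_assoc, hb, neg_mul, mul_assoc, h' r, ← mul_assoc b, ← hc, pow_succ]
        noncomm_ring
      rw [listEsymm_succ_cons, mul_add, h', hr, add_mul, mul_add]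

/-- The defining recursion solved for the shorter list. For `r` beyond the length of `L` the left
side vanishes, leaving a monic equation for `-a` over the symmetric polynomials in `a :: L`. -/
theorem listEsymm_eq_sum_cons (r : ℕ) (a : R) (L : List R) :
    listEsymm r L = ∑ j ∈ range (r + 1), (-a) ^ j * listEsymm (r - j) (a :: L) := by
  induction r with
  | zero => simp
  | succ r ih =>
    rw [sum_range_succ', pow_zero, one_mul, Nat.sub_zero, listEsymm_succ_cons]
    simp only [Nat.add_sub_add_right, pow_succ', mul_assoc]
    rw [← mul_sum, ← ih]
    noncomm_ring

theorem listEsymm_succ_concat (r : ℕ) (a : R) (L : List R) :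
    listEsymm (r + 1) (L ++ [a]) = listEsymm (r + 1) L + listEsymm r L * a := by
  induction L generalizing r with
  | nil => cases r <;> simp [listEsymm_succ_cons]
  | cons b L ih =>
    cases r with
    | zero => simp only [List.cons_append, listEsymm_succ_cons, ih, listEsymm_zero]; abel
    | succ r =>
      simp only [List.cons_append, listEsymm_succ_cons, ih]
      noncomm_ring

/-- Reversing a product of `r` anticommuting factors takes `r(r-1)/2` transpositions. Needed because
`w0` reverses the variables. -/
theorem listEsymm_reverse {L : List R} (h : L.Pairwise fun a b => a * b = -(b * a)) (r : ℕ) :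
    listEsymm r L.reverse = (-1) ^ (∑ j ∈ range r, j) * listEsymm r L := by
  induction L generalizing r with
  | nil => cases r <;> simp
  | cons a L ih =>
    rw [List.pairwise_cons] at h
    cases r with
    | zero => simp
    | succ r =>
      have hr := mul_listEsymm_of_anticomm h.1 r
      have h2 : (-1 : R) ^ r * (-1) ^ r = 1 := by rw [← pow_add, ← two_mul]; simp
      rw [List.reverse_cons, listEsymm_succ_concat, ih h.2, ih h.2, listEsymm_succ_cons, hr,
        mul_add, sum_range_succ, pow_add, mul_assoc _ _ (_ * (_ * _)), ← mul_assoc (_ ^ r), h2,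
        one_mul, mul_assoc, mul_assoc, ← mul_add]

theorem sum_powersetCard_sort_prod {ι : Type*} [LinearOrder ι] (f : ι → R) (r : ℕ) {l : List ι}
    (hl : l.Pairwise (· < ·)) :
    ∑ s ∈ powersetCard r l.toFinset, ((s.sort (· ≤ ·)).map f).prod = listEsymm r (l.map f) := by
  induction l generalizing r with
  | nil =>
    cases r with
    | zero => simp
    | succ r => rw [powersetCard_eq_empty.2 (by simp)]; simp
  | cons a l ih =>
    rw [List.pairwise_cons] at hl
    cases r with
    | zero => simp
    | succ r =>
      have ha : a ∉ l.toFinset := fun h => lt_irrefl a (hl.1 a (List.mem_toFinset.1 h))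
      have hs : ∀ s ∈ powersetCard r l.toFinset, a ∉ s := fun s hs h =>
        ha ((mem_powersetCard.1 hs).1 h)
      rw [List.toFinset_cons, powersetCard_succ_insert ha, sum_union, ih (r + 1) hl.2, sum_image,
        List.map_cons, listEsymm_succ_cons, ← ih r hl.2, mul_sum]
      · congr 1
        refine sum_congr rfl fun s h => ?_
        rw [sort_insert _ _ (hs s h), List.map_cons, List.prod_cons]
        exact fun b hb => (hl.1 b (List.mem_toFinset.1 ((mem_powersetCard.1 h).1 hb))).le
      · intro s h t h' e
        rw [← erase_insert (hs s h), ← erase_insert (hs t h')]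
        exact congrArg (fun u => u.erase a) e
      · rw [disjoint_left]
        intro s h h'
        obtain ⟨t, -, rfl⟩ := mem_image.1 h'
        exact ha ((mem_powersetCard.1 h).1 (mem_insert_self _ _))

end ListEsymm

/-! ### Signs of products of ordered monomials in anticommuting elements -/

section OrderedMonomials

variable {R : Type*} [Ring R]

theorem mul_prod_ofFn_eq {m : ℕ} {b : R} (y : Fin m → R) (e : Fin m → ℕ)
    (h : ∀ i, b * y i = (-1) ^ e i * (y i * b)) :
    b * (List.ofFn y).prod = (-1) ^ (∑ i, e i) * ((List.ofFn y).prod * b) := by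
  induction m with
  | zero => simp
  | succ m ih =>
    have hc : y 0 * (-1) ^ (∑ i : Fin m, e i.succ) = (-1) ^ (∑ i : Fin m, e i.succ) * y 0 :=
      ((Commute.neg_one_left _).pow_left _).eq.symm
    simp only [List.ofFn_succ, List.prod_cons, Fin.sum_univ_succ]
    rw [← mul_assoc, h, mul_assoc, mul_assoc, ih (fun i => y i.succ) _ (fun i => h i.succ),
      ← mul_assoc (y 0), hc, pow_add]
    simp only [mul_assoc]

theorem mul_pow_of_anticomm {b c : R} (h : b * c = -(c * b)) (e : ℕ) :
    b * c ^ e = (-1) ^ e * (c ^ e * b) := by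
  induction e with
  | zero => simp
  | succ e ih =>
    rw [pow_succ, ← mul_assoc, ih, pow_succ, mul_assoc, mul_assoc (c ^ e), h]
    noncomm_ring

/-- The new factor only crosses the blocks before its own; this is the source of the sign
`(-1)^{|λ/i|}`. -/
theorem mul_prod_ofFn_pow {m : ℕ} (v : Fin m → R) (h : ∀ i j, i ≠ j → v i * v j = -(v j * v i))
    (a : Fin m → ℕ) (i : Fin m) :
    v i * (List.ofFn fun j => v j ^ a j).prod = (-1) ^ (∑ j ∈ univ.filter (· < i), a j) *
      (List.ofFn fun j => v j ^ Function.update a i (a i + 1) j).prod := by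
  induction m with
  | zero => exact i.elim0
  | succ m ih =>
    have hc : ∀ (e : ℕ) (y : R), y * (-1) ^ e = (-1) ^ e * y := fun e y =>
      ((Commute.neg_one_left y).pow_left e).eq.symm
    simp only [List.ofFn_succ, List.prod_cons]
    refine Fin.cases ?_ (fun i => ?_) i
    · simp [pow_succ', mul_assoc]
    · have hs : ∑ j ∈ univ.filter (· < i.succ), a j =
          a 0 + ∑ j ∈ univ.filter (· < i), a j.succ := by
        simp only [sum_filter, Fin.sum_univ_succ, Fin.succ_lt_succ_iff, Fin.succ_pos, if_true]
      have hu : ∀ j : Fin m, Function.update a i.succ (a i.succ + 1) j.succ =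
          Function.update (fun j => a j.succ) i (a i.succ + 1) j := by
        intro j
        simp only [Function.update_apply, Fin.succ_inj]
      simp only [hu, hs]
      rw [← mul_assoc, mul_pow_of_anticomm (h _ _ (Fin.succ_ne_zero i)), mul_assoc, mul_assoc,
        ih (fun j => v j.succ)
        (fun j l hjl => h _ _ fun e => hjl (Fin.succ_injective _ e)),
        ← mul_assoc (v 0 ^ _), hc, pow_add, Function.update_of_ne (Fin.succ_ne_zero i).symm]
      simp only [mul_assoc]

theorem mul_prod_ofFn_pow_comm {m : ℕ} (v : Fin m → R)
    (h : ∀ i j, i ≠ j → v i * v j = -(v j * v i)) (a : Fin m → ℕ) (i : Fin m) :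
    v i * (List.ofFn fun j => v j ^ a j).prod =
      (-1) ^ (a i + ∑ j, a j) * ((List.ofFn fun j => v j ^ a j).prod * v i) := by
  rw [mul_prod_ofFn_eq (fun j => v j ^ a j) (fun j => if j = i then 0 else a j)]
  · have hs : a i + ∑ j, a j = (∑ j, if j = i then 0 else a j) + 2 * a i := by
      have : ∑ j, a j = (∑ j, if j = i then 0 else a j) + ∑ j, if j = i then a j else 0 := by
        rw [← sum_add_distrib]
        exact sum_congr rfl fun j _ => by split_ifs <;> simp
      rw [this, sum_ite_eq' univ i, if_pos (mem_univ i)]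
      ring
    rw [hs, pow_add, pow_mul, neg_one_sq, one_pow, mul_one]
  · intro j
    by_cases hj : j = i
    · subst hj
      rw [if_pos rfl, pow_zero, one_mul, ← pow_succ', pow_succ]
    · rw [if_neg hj, mul_pow_of_anticomm (h _ _ (Ne.symm hj))]

/-- The exact sign is left open, since the lemma only serves to show that certain terms vanish. -/
theorem prod_ofFn_pow_mul_prod_ofFn_pow {m : ℕ} (v : Fin m → R)
    (h : ∀ i j, i ≠ j → v i * v j = -(v j * v i)) (a b : Fin m → ℕ) :
    ∃ e : ℕ, (List.ofFn fun j => v j ^ a j).prod * (List.ofFn fun j => v j ^ b j).prod =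
      (-1) ^ e * (List.ofFn fun j => v j ^ (a j + b j)).prod := by
  induction m with
  | zero => exact ⟨0, by simp⟩
  | succ m ih =>
    obtain ⟨e, he⟩ := ih (fun j => v j.succ)
      (fun j l hjl => h _ _ fun e => hjl (Fin.succ_injective _ e)) (fun j => a j.succ)
      (fun j => b j.succ)
    have h0 := mul_prod_ofFn_eq (b := v 0 ^ b 0) (fun j : Fin m => v j.succ ^ a j.succ)
      (fun j => a j.succ * b 0) (fun j => by
        have h1 := mul_pow_of_anticomm (h _ _ (Fin.succ_ne_zero j).symm) (a j.succ)
        rw [pow_mul]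
        generalize v j.succ ^ a j.succ = y at *
        induction b 0 with
        | zero => simp
        | succ c ihc =>
          have hc : v 0 ^ c * (-1) ^ a j.succ = (-1) ^ a j.succ * v 0 ^ c :=
            ((Commute.neg_one_left _).pow_left _).eq.symm
          rw [pow_succ, mul_assoc, h1, ← mul_assoc, hc, mul_assoc, ← mul_assoc (v 0 ^ c), ihc,
            pow_succ']
          simp only [mul_assoc])
    have hs : ∀ (e : ℕ) (y : R), y * (-1) ^ e = (-1) ^ e * y := fun e y =>
      ((Commute.neg_one_left y).pow_left e).eq.symm
    have h1 := congrArg (fun y => (-1) ^ (∑ j : Fin m, a j.succ * b 0) * y) h0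
    rw [← mul_assoc, ← mul_assoc, ← pow_add, ← two_mul, pow_mul, neg_one_sq, one_pow,
      one_mul] at h1
    simp only [List.ofFn_succ, List.prod_cons]
    refine ⟨(∑ j : Fin m, a j.succ * b 0) + e, ?_⟩
    rw [mul_assoc, ← mul_assoc _ (v 0 ^ b 0), ← h1, mul_assoc, mul_assoc, he, ← mul_assoc (v 0 ^ a 0),
      hs, mul_assoc, ← mul_assoc (v 0 ^ b 0), hs, mul_assoc, ← mul_assoc (v 0 ^ a 0), hs, pow_add,
      pow_add]
    simp only [mul_assoc]

theorem prod_ofFn_mem_of_adjacent {S : Subring R} {m : ℕ} (y : Fin m → R) {i : ℕ}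
    (hi : i + 1 < m) (h : ∀ j : Fin m, (j : ℕ) ≠ i → (j : ℕ) ≠ i + 1 → y j ∈ S)
    (hmul : y ⟨i, Nat.lt_of_succ_lt hi⟩ * y ⟨i + 1, hi⟩ ∈ S) : (List.ofFn y).prod ∈ S := by
  induction m generalizing i with
  | zero => omega
  | succ m ih =>
    rw [List.ofFn_succ, List.prod_cons]
    cases i with
    | zero =>
      obtain ⟨m, rfl⟩ : ∃ l, m = l + 1 := ⟨m - 1, by omega⟩
      rw [List.ofFn_succ, List.prod_cons, ← mul_assoc]
      refine S.mul_mem hmul (S.list_prod_mem fun z hz => ?_)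
      obtain ⟨j, rfl⟩ := (List.mem_ofFn' _ _).1 hz
      exact h _ (by simp) (by simp)
    | succ i =>
      exact S.mul_mem (h 0 (by simp) (by simp)) (ih (fun j => y j.succ) (by omega)
        (fun j h1 h2 => h _ (by simpa using h1) (by simpa using h2)) hmul)

end OrderedMonomials

end OPol

namespace OPol

/-! ### Spanning by staircase products over the symmetric polynomials -/

section StaircaseSpan

variable {k R : Type*} [CommRing k] [Ring R] [Algebra k R]

/-- The subalgebra of elements which map a submodule to itself by left multiplication. -/
def leftStabilizer (W : Submodule k R) : Subalgebra k R where
  carrier := {f | ∀ w ∈ W, f * w ∈ W}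
  mul_mem' hf hg w hw := by rw [mul_assoc]; exact hf _ (hg w hw)
  add_mem' hf hg w hw := by rw [add_mul]; exact W.add_mem (hf w hw) (hg w hw)
  algebraMap_mem' c w hw := by rw [← Algebra.smul_def]; exact W.smul_mem c hw

theorem mem_leftStabilizer {W : Submodule k R} {f : R} :
    f ∈ leftStabilizer W ↔ ∀ w ∈ W, f * w ∈ W := Iff.rfl

theorem mem_leftStabilizer_iff_span {W : Submodule k R} {f : R} :
    f ∈ leftStabilizer W ↔ Submodule.span k {f} * W ≤ W := by
  rw [mem_leftStabilizer, Submodule.mul_le]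
  refine ⟨fun h m hm w hw => ?_, fun h w hw => h f (Submodule.mem_span_singleton_self f) w hw⟩
  obtain ⟨c, rfl⟩ := Submodule.mem_span_singleton.1 hm
  rw [smul_mul_assoc]
  exact W.smul_mem c (h w hw)

theorem toSubmodule_mul_le {W : Submodule k R} {S : Subalgebra k R} (h : S ≤ leftStabilizer W) :
    S.toSubmodule * W ≤ W :=
  Submodule.mul_le.2 fun _ hf w hw => h hf w hw

/-- A span does not see signs, so elements commuting up to sign have commuting spans. The spanning
argument therefore runs in the semiring of submodules as in the commutative case. -/
theorem commute_span_singleton {a b : R} (r : ℕ) (h : a * b = (-1) ^ r * (b * a)) :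
    Commute (Submodule.span k {a}) (Submodule.span k {b}) := by
  rw [commute_iff_eq, Submodule.span_mul_span, Submodule.span_mul_span, Set.singleton_mul_singleton,
    Set.singleton_mul_singleton, h]
  rcases neg_one_pow_eq_or R r with h | h
  · rw [h, one_mul]
  · rw [h, neg_one_mul, ← Set.neg_singleton, Submodule.span_neg]

theorem one_sup_pow_succ_le (X : Submodule k R) (m : ℕ) :
    (1 ⊔ X) ^ (m + 1) ≤ (1 ⊔ X) ^ m ⊔ X ^ (m + 1) := by
  induction m with
  | zero => simp
  | succ m ih =>
    have h1 : X ^ (m + 1) ≤ (1 ⊔ X) ^ (m + 1) := pow_le_pow_left' le_sup_right _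
    calc (1 ⊔ X) ^ (m + 2) = (1 ⊔ X) * (1 ⊔ X) ^ (m + 1) := pow_succ' _ _
      _ ≤ (1 ⊔ X) * ((1 ⊔ X) ^ m ⊔ X ^ (m + 1)) := mul_le_mul' le_rfl ih
      _ = (1 ⊔ X) ^ (m + 1) ⊔ (X ^ (m + 1) ⊔ X ^ (m + 2)) := by
        rw [Submodule.mul_sup, ← pow_succ', Submodule.sup_mul 1 X, one_mul, ← pow_succ']
      _ ≤ _ := sup_le le_sup_left (sup_le (h1.trans le_sup_left) le_sup_right)

variable (k) in
/-- The algebra generated by the ordered elementary symmetric polynomials in a list. -/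
def listSymmAlgebra (L : List R) : Subalgebra k R :=
  Algebra.adjoin k (Set.range fun r => listEsymm r L)

theorem listEsymm_mem_listSymmAlgebra (r : ℕ) (L : List R) :
    listEsymm r L ∈ listSymmAlgebra k L :=
  Algebra.subset_adjoin ⟨r, rfl⟩

variable (k) in
/-- The span of the products `⋯ a_2 ^ j_2 * a_1 ^ j_1` with `j_i ≤ q - i`, for a list
`[a_1, …, a_q]`. -/
def staircaseSpan : List R → Submodule k R
  | [] => 1
  | a :: L => staircaseSpan L * (1 ⊔ Submodule.span k {a}) ^ L.length

theorem one_le_staircaseSpan (L : List R) : 1 ≤ staircaseSpan k L := by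
  induction L with
  | nil => exact le_rfl
  | cons a L ih =>
    calc (1 : Submodule k R) = 1 * 1 ^ L.length := by rw [one_pow, mul_one]
      _ ≤ _ := mul_le_mul' ih (pow_le_pow_left' le_sup_left _)

/-- The degree bound `0 + 1 + ⋯ + (q - 1)` is exactly the number of divided differences in `∂_{w0}`
for `q` variables. -/
theorem staircaseSpan_le {V : Submodule k R} {L : List R} (h : ∀ a ∈ L, a ∈ V) :
    staircaseSpan k L ≤ (1 ⊔ V) ^ ∑ j ∈ range L.length, j := by
  induction L with
  | nil => exact le_rfl
  | cons a L ih =>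
    rw [List.length_cons, sum_range_succ, pow_add]
    refine mul_le_mul' (ih fun b hb => h b (List.mem_cons_of_mem _ hb))
      (pow_le_pow_left' (sup_le_sup_left ?_ _) _)
    exact (Submodule.span_singleton_le_iff_mem _ _).2 (h a List.mem_cons_self)

theorem commute_span_staircaseSpan {a : R} {L : List R} (h : ∀ b ∈ L, a * b = -(b * a)) :
    Commute (Submodule.span k {a}) (staircaseSpan k L) := by
  induction L with
  | nil => exact Commute.one_right _
  | cons b L ih =>
    refine (ih fun c hc => h c (List.mem_cons_of_mem _ hc)).mul_right (Commute.pow_right ?_ _)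
    exact (Commute.one_right _).add_right
      (commute_span_singleton 1 (by rw [h b List.mem_cons_self, pow_one, neg_one_mul]))

/-- The products of the span of bounded powers of `a` and the symmetric polynomials
in `a :: L` are stable under `a` and under the symmetric polynomials in `L`. -/
theorem stable_powers_mul_listSymmAlgebra {a : R} {L : List R} (h : ∀ b ∈ L, a * b = -(b * a)) :
    a ∈ leftStabilizer ((1 ⊔ Submodule.span k {a}) ^ L.length *
        (listSymmAlgebra k (a :: L)).toSubmodule) ∧
      listSymmAlgebra k L ≤ leftStabilizer ((1 ⊔ Submodule.span k {a}) ^ L.length *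
        (listSymmAlgebra k (a :: L)).toSubmodule) := by
  set X := Submodule.span k {a} with hX
  set N := (1 ⊔ X) ^ L.length with hN
  set A := (listSymmAlgebra k (a :: L)).toSubmodule with hA
  have hAA : A * A = A := by rw [hA, (Subalgebra.isIdempotentElem_toSubmodule _).eq]
  have hone : (1 : Submodule k R) ≤ A := by
    rw [Submodule.one_le]
    exact (listSymmAlgebra k (a :: L)).one_mem
  have haX : a ∈ X := Submodule.mem_span_singleton_self a
  have hpow : ∀ j ≤ L.length, (-a) ^ j ∈ N := fun j hj => by
    have h1 : (-a) ^ j ∈ (1 ⊔ X) ^ j :=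
      Submodule.pow_mem_pow _ (Submodule.mem_sup_right (X.neg_mem haX)) j
    have h2 : (1 ⊔ X) ^ j ≤ N := pow_le_pow_right₀ le_sup_left hj
    exact h2 h1
  have hterm : ∀ j ≤ L.length, ∀ r, (-a) ^ j * listEsymm r (a :: L) ∈ N * A := fun j hj r =>
    Submodule.mul_mem_mul (hpow j hj) (listEsymm_mem_listSymmAlgebra r _)
  -- The monic equation for `-a`, obtained from the vanishing of the elementary polynomial of degree
  -- `L.length + 1` in `L`, reduces the first power outside `N`.
  have hlead : (-a) ^ (L.length + 1) ∈ N * A := by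
    have h0 := listEsymm_eq_sum_cons (L.length + 1) a L
    rw [listEsymm_of_length_lt (Nat.lt_succ_self _), sum_range_succ, Nat.sub_self, listEsymm_zero,
      mul_one] at h0
    rw [← neg_eq_of_add_eq_zero_right h0.symm]
    exact Submodule.neg_mem _ (Submodule.sum_mem _ fun j hj =>
      hterm j (Nat.lt_succ_iff.1 (mem_range.1 hj)) _)
  have hNle : N ≤ N * A := by simpa using mul_le_mul' (le_refl N) hone
  have hXN : (1 ⊔ X) * (N * A) ≤ N * A := by
    have h1 : (1 ⊔ X) * N ≤ N * A := by
      rw [hN, ← pow_succ']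
      refine (one_sup_pow_succ_le X _).trans (sup_le hNle ?_)
      have : X ^ (L.length + 1) = Submodule.span k {(-a) ^ (L.length + 1)} := by
        have hneg : X = Submodule.span k {-a} := by
          rw [hX, ← Set.neg_singleton, Submodule.span_neg]
        rw [hneg, Submodule.span_pow, Set.singleton_pow]
      rw [this]
      exact (Submodule.span_singleton_le_iff_mem _ _).2 hlead
    calc (1 ⊔ X) * (N * A) = (1 ⊔ X) * N * A := (mul_assoc _ _ _).symm
      _ ≤ N * A * A := mul_le_mul' h1 le_rfl
      _ = N * A := by rw [mul_assoc, hAA]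
  have hNN : N * (N * A) ≤ N * A := by
    have : ∀ j, (1 ⊔ X) ^ j * (N * A) ≤ N * A := fun j => by
      induction j with
      | zero => simp
      | succ j ih =>
        rw [pow_succ, mul_assoc]
        exact (mul_le_mul' le_rfl hXN).trans ih
    exact this _
  refine ⟨fun w hw => hXN (Submodule.mul_mem_mul (Submodule.mem_sup_right haX) hw), ?_⟩
  refine Algebra.adjoin_le ?_
  rintro _ ⟨r, rfl⟩
  have hmem : listEsymm r L ∈ N * A := by
    by_cases hr : r ≤ L.length
    · rw [listEsymm_eq_sum_cons r a L]
      exact Submodule.sum_mem _ fun j hj =>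
        hterm j ((Nat.lt_succ_iff.1 (mem_range.1 hj)).trans hr) _
    · rw [listEsymm_of_length_lt (not_le.1 hr)]
      exact Submodule.zero_mem _
  -- Moving the line through `N` places `listEsymm r L` next to `A`, where it can be rewritten
  -- inside `N * A`.
  have hc : Commute (Submodule.span k {listEsymm r L}) N :=
    ((Commute.one_right _).add_right
      (commute_span_singleton r (mul_listEsymm_of_anticomm h r)).symm).pow_right _
  refine mem_leftStabilizer_iff_span.2 ?_
  calc Submodule.span k {listEsymm r L} * (N * A)
      = N * (Submodule.span k {listEsymm r L} * A) := by rw [← mul_assoc, hc.eq, mul_assoc]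
    _ ≤ N * (N * A * A) := mul_le_mul' le_rfl (mul_le_mul'
        ((Submodule.span_singleton_le_iff_mem _ _).2 hmem) le_rfl)
    _ ≤ N * A := by rw [mul_assoc, hAA]; exact hNN

/-- Induction on the list. The head passes through the staircase of the tail and is absorbed by its
bounded powers. An entry of the tail is absorbed by the smaller staircase at the cost of a symmetric
polynomial in the tail, which the preceding stability result absorbs in turn. -/
theorem mem_leftStabilizer_staircaseSpan {L : List R}
    (hL : L.Pairwise fun a b => a * b = -(b * a)) {a : R} (ha : a ∈ L) :
    a ∈ leftStabilizer (staircaseSpan k L * (listSymmAlgebra k L).toSubmodule) := by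
  induction L generalizing a with
  | nil => simp at ha
  | cons b L ih =>
    rw [List.pairwise_cons] at hL
    obtain ⟨h1, h2⟩ := stable_powers_mul_listSymmAlgebra (k := k) hL.1
    rw [staircaseSpan, mul_assoc]
    set W := (1 ⊔ Submodule.span k {b}) ^ L.length * (listSymmAlgebra k (b :: L)).toSubmodule
    rw [mem_leftStabilizer_iff_span]
    rcases List.mem_cons.1 ha with rfl | ha
    · rw [← mul_assoc, (commute_span_staircaseSpan hL.1).eq, mul_assoc]
      exact mul_le_mul' le_rfl (mem_leftStabilizer_iff_span.1 h1)
    · have h3 := mem_leftStabilizer_iff_span.1 (ih hL.2 ha)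
      have h4 : (1 : Submodule k R) ≤ (listSymmAlgebra k L).toSubmodule :=
        Submodule.one_le.2 (listSymmAlgebra k L).one_mem
      calc Submodule.span k {a} * (staircaseSpan k L * W)
          = Submodule.span k {a} * (staircaseSpan k L * 1) * W := by rw [mul_one, mul_assoc]
        _ ≤ Submodule.span k {a} * (staircaseSpan k L * (listSymmAlgebra k L).toSubmodule) * W :=
          mul_le_mul' (mul_le_mul' le_rfl (mul_le_mul' le_rfl h4)) le_rfl
        _ ≤ staircaseSpan k L * (listSymmAlgebra k L).toSubmodule * W :=
          mul_le_mul' h3 le_rfl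
        _ = staircaseSpan k L * ((listSymmAlgebra k L).toSubmodule * W) := mul_assoc _ _ _
        _ ≤ staircaseSpan k L * W := mul_le_mul' le_rfl (toSubmodule_mul_le h2)

end StaircaseSpan

end OPol

namespace OPol

/-! ### Odd nilHecke relations and the common kernel of the divided differences -/

section NilHecke

variable {k : Type*} [CommRing k] {n : ℕ}

theorem x_mul_x {i j : Fin n} (h : i ≠ j) : (x i * x j : OPol k n) = -(x j * x i) :=
  eq_neg_of_add_eq_zero_left (x_anticomm h)

theorem induction_left {P : OPol k n → Prop} (f : OPol k n) (h1 : P 1)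
    (hsmul : ∀ (c : k) f, P f → P (c • f)) (hadd : ∀ f g, P f → P g → P (f + g))
    (hx : ∀ i f, P f → P (x i * f)) : P f := by
  have key : ∀ g, P g → P (f * g) := by
    induction f using induction_on with
    | hc c => intro g hg; rw [← Algebra.smul_def]; exact hsmul c g hg
    | hx i => exact hx i
    | hmul f₁ f₂ h₁ h₂ => intro g hg; rw [mul_assoc]; exact h₁ _ (h₂ _ hg)
    | hadd f₁ f₂ h₁ h₂ => intro g hg; rw [add_mul]; exact hadd _ _ (h₁ _ hg) (h₂ _ hg)
  simpa using key 1 h1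

/-- Reduces an operator identity to its value at 1 and one application of the Leibniz rule per
generator. -/
theorem linearMap_ext_left {M : Type*} [AddCommGroup M] [Module k M] {φ ψ : OPol k n →ₗ[k] M}
    (h1 : φ 1 = ψ 1) (hx : ∀ i f, φ f = ψ f → φ (x i * f) = ψ (x i * f)) : φ = ψ := by
  ext f
  induction f using induction_left with
  | h1 => exact h1
  | hsmul c f h => rw [map_smul, map_smul, h]
  | hadd f g hf hg => rw [map_add, map_add, hf, hg]
  | hx i f h => exact hx i f h

theorem dividedDiffSwap_x_mul (a b j : Fin n) (f : OPol k n) :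
    dividedDiffSwap a b (x j * f) =
      (if j = a ∨ j = b then f else 0) - x (Equiv.swap a b j) * dividedDiffSwap a b f := by
  rw [dividedDiffSwap, skewDer_mul, skewDer_x]
  simp [parity, permAct, sub_eq_add_neg]

theorem dividedDiffSwap_one (a b : Fin n) : dividedDiffSwap a b (1 : OPol k n) = 0 :=
  skewDer_one _ _ _

theorem dividedDiffSwap_dividedDiffSwap_self (a b : Fin n) (f : OPol k n) :
    dividedDiffSwap a b (dividedDiffSwap a b f) = 0 := by
  refine LinearMap.congr_fun (f := dividedDiffSwap a b ∘ₗ dividedDiffSwap a b) (g := 0)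
    (linearMap_ext_left ?_ fun j f h => ?_) f
  · simp [dividedDiffSwap_one]
  · rw [LinearMap.zero_apply, LinearMap.comp_apply] at h ⊢
    rw [dividedDiffSwap_x_mul, map_sub, dividedDiffSwap_x_mul, h, mul_zero, sub_zero]
    by_cases ha : j = a
    · subst ha; simp
    · by_cases hb : j = b
      · subst hb; simp
      · simp [ha, hb, Equiv.swap_apply_of_ne_of_ne]

theorem dividedDiffSwap_anticomm {a b c e : Fin n} (hac : a ≠ c) (hae : a ≠ e) (hbc : b ≠ c)
    (hbe : b ≠ e) (f : OPol k n) :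
    dividedDiffSwap a b (dividedDiffSwap c e f) = -dividedDiffSwap c e (dividedDiffSwap a b f) := by
  refine LinearMap.congr_fun (f := dividedDiffSwap a b ∘ₗ dividedDiffSwap c e)
    (g := -(dividedDiffSwap c e ∘ₗ dividedDiffSwap a b)) (linearMap_ext_left ?_ fun j f h => ?_) f
  · simp [dividedDiffSwap_one]
  · rw [LinearMap.neg_apply, LinearMap.comp_apply, LinearMap.comp_apply] at h ⊢
    rw [dividedDiffSwap_x_mul, dividedDiffSwap_x_mul, map_sub, map_sub, dividedDiffSwap_x_mul,
      dividedDiffSwap_x_mul, h]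
    by_cases ha : j = a
    · subst ha
      simp [hac, hae, hbc, hbe, Equiv.swap_apply_of_ne_of_ne]
    by_cases hb : j = b
    · subst hb
      simp [hac, hae, hbc, hbe, Equiv.swap_apply_of_ne_of_ne]
    by_cases hc : j = c
    · subst hc
      simp [hac.symm, hae.symm, hbc.symm, hbe.symm, Equiv.swap_apply_of_ne_of_ne]
    by_cases he : j = e
    · subst he
      simp [hac.symm, hae.symm, hbc.symm, hbe.symm, Equiv.swap_apply_of_ne_of_ne]
    simp [ha, hb, hc, he, Equiv.swap_apply_of_ne_of_ne]

theorem dividedDiffSwap_braid {a b c : Fin n} (hab : a ≠ b) (hac : a ≠ c) (hbc : b ≠ c)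
    (f : OPol k n) :
    dividedDiffSwap a b (dividedDiffSwap b c (dividedDiffSwap a b f)) =
      dividedDiffSwap b c (dividedDiffSwap a b (dividedDiffSwap b c f)) := by
  refine LinearMap.congr_fun
    (f := dividedDiffSwap a b ∘ₗ dividedDiffSwap b c ∘ₗ dividedDiffSwap a b)
    (g := dividedDiffSwap b c ∘ₗ dividedDiffSwap a b ∘ₗ dividedDiffSwap b c)
    (linearMap_ext_left ?_ fun j f h => ?_) f
  · simp [dividedDiffSwap_one]
  · simp only [LinearMap.comp_apply] at h ⊢
    simp only [dividedDiffSwap_x_mul, map_sub, h]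
    by_cases ha : j = a
    · subst ha
      simp [hab, hac, hbc, hac.symm, hbc.symm, Equiv.swap_apply_of_ne_of_ne,
        dividedDiffSwap_dividedDiffSwap_self]
    by_cases hb : j = b
    · subst hb
      simp [hab, hac, hbc, hab.symm, hac.symm, hbc.symm, Equiv.swap_apply_of_ne_of_ne]
      abel
    by_cases hc : j = c
    · subst hc
      simp [hab, hac, hab.symm, hac.symm, hbc.symm, Equiv.swap_apply_of_ne_of_ne,
        dividedDiffSwap_dividedDiffSwap_self]
    simp [ha, hb, hc, Equiv.swap_apply_of_ne_of_ne]

theorem dividedDiff_of_lt {i : ℕ} (h : i + 1 < n) : (dividedDiff i : OPol k n →ₗ[k] OPol k n) =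
    dividedDiffSwap ⟨i, Nat.lt_of_succ_lt h⟩ ⟨i + 1, h⟩ := dif_pos h

theorem dividedDiff_of_le {i : ℕ} (h : n ≤ i + 1) :
    (dividedDiff i : OPol k n →ₗ[k] OPol k n) = 0 := dif_neg (not_lt.2 h)

theorem dividedDiff_one (i : ℕ) : dividedDiff i (1 : OPol k n) = 0 := by
  by_cases h : i + 1 < n
  · rw [dividedDiff_of_lt h, dividedDiffSwap_one]
  · rw [dividedDiff_of_le (not_lt.1 h), LinearMap.zero_apply]

theorem dividedDiff_dividedDiff_self (i : ℕ) (f : OPol k n) :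
    dividedDiff i (dividedDiff i f) = 0 := by
  by_cases h : i + 1 < n
  · rw [dividedDiff_of_lt h, dividedDiffSwap_dividedDiffSwap_self]
  · rw [dividedDiff_of_le (not_lt.1 h), LinearMap.zero_apply]

theorem dividedDiff_anticomm {i j : ℕ} (hij : i + 1 < j) (f : OPol k n) :
    dividedDiff j (dividedDiff i f) = -dividedDiff i (dividedDiff j f) := by
  by_cases h : j + 1 < n
  · rw [dividedDiff_of_lt h, dividedDiff_of_lt (i := i) (by omega)]
    refine dividedDiffSwap_anticomm ?_ ?_ ?_ ?_ f <;> simp only [ne_eq, Fin.mk.injEq] <;> omega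
  · rw [dividedDiff_of_le (i := j) (not_lt.1 h), LinearMap.zero_apply, LinearMap.zero_apply, map_zero,
      neg_zero]

theorem dividedDiff_braid (i : ℕ) (f : OPol k n) :
    dividedDiff i (dividedDiff (i + 1) (dividedDiff i f)) =
      dividedDiff (i + 1) (dividedDiff i (dividedDiff (i + 1) f)) := by
  by_cases h : i + 1 + 1 < n
  · rw [dividedDiff_of_lt h, dividedDiff_of_lt (i := i) (by omega)]
    refine dividedDiffSwap_braid ?_ ?_ ?_ f <;> simp only [ne_eq, Fin.mk.injEq] <;> omega
  · rw [dividedDiff_of_le (i := i + 1) (not_lt.1 h)]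
    simp

/-- One braid move lowers the index; the other `m - 2` factors are distant and contribute a sign
each. -/
theorem dividedDiffDesc_dividedDiff {m i : ℕ} (h : i + 1 < m) (f : OPol k n) :
    dividedDiffDesc m (dividedDiff (i + 1) f) =
      (-1 : k) ^ m • dividedDiff i (dividedDiffDesc m f) := by
  induction m generalizing i with
  | zero => omega
  | succ m ih =>
    simp only [dividedDiffDesc, LinearMap.comp_apply]
    by_cases hm : i + 1 < m
    · rw [ih hm, map_smul, dividedDiff_anticomm hm, pow_succ, smul_neg, mul_neg_one, neg_smul]
    · obtain rfl : m = i + 1 := by omega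
      have hcomm : ∀ l ≤ i, ∀ g : OPol k n,
          dividedDiffDesc l (dividedDiff (i + 1) g) =
            (-1 : k) ^ l • dividedDiff (i + 1) (dividedDiffDesc l g) := by
        intro l
        induction l with
        | zero => intro _ g; simp [dividedDiffDesc]
        | succ l ihl =>
          intro hl g
          simp only [dividedDiffDesc, LinearMap.comp_apply]
          rw [ihl (by omega), map_smul, dividedDiff_anticomm (i := l) (by omega), pow_succ, smul_neg,
            mul_neg_one, neg_smul, neg_neg]
      simp only [dividedDiffDesc, LinearMap.comp_apply]
      rw [hcomm i le_rfl, map_smul, map_smul, ← dividedDiff_braid]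
      congr 1
      rw [pow_succ, pow_succ]; ring

theorem dividedDiffDesc_dividedDiff_zero {m : ℕ} (h : 0 < m) (f : OPol k n) :
    dividedDiffDesc m (dividedDiff 0 f) = 0 := by
  induction m with
  | zero => omega
  | succ m ih =>
    cases m with
    | zero => simp [dividedDiffDesc, dividedDiff_dividedDiff_self]
    | succ m => rw [dividedDiffDesc, LinearMap.comp_apply, ih m.succ_pos, map_zero]

/-- Each descending block crossed lowers the index by one until it is 0; the next block then ends in
`∂_0` on the right, and `∂_0² = 0`. -/
theorem dividedDiffStair_dividedDiff {m i : ℕ} (h : i + 1 < m) (f : OPol k n) :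
    dividedDiffStair m (dividedDiff i f) = 0 := by
  induction m generalizing i f with
  | zero => omega
  | succ m ih =>
    rw [dividedDiffStair, LinearMap.comp_apply]
    cases i with
    | zero => rw [dividedDiffDesc_dividedDiff_zero (by omega), map_zero]
    | succ i => rw [dividedDiffDesc_dividedDiff (by omega), map_smul, ih (by omega), smul_zero]

variable (k n) in
/-- The kernel of an odd divided difference operator, as a subalgebra. -/
def dividedDiffKernel (i : ℕ) : Subalgebra k (OPol k n) where
  carrier := {f | dividedDiff i f = 0}
  mul_mem' {f g} hf hg := by
    rw [Set.mem_ofPred_eq] at *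
    by_cases h : i + 1 < n
    · rw [dividedDiff_mul h, hf, hg, zero_mul, mul_zero, add_zero]
    · rw [dividedDiff_of_le (not_lt.1 h), LinearMap.zero_apply]
  add_mem' {f g} hf hg := by
    rw [Set.mem_ofPred_eq] at *
    rw [map_add, hf, hg, add_zero]
  algebraMap_mem' c := by
    rw [Set.mem_ofPred_eq, Algebra.algebraMap_eq_smul_one, map_smul, dividedDiff_one, smul_zero]

theorem mem_dividedDiffKernel {i : ℕ} {f : OPol k n} :
    f ∈ dividedDiffKernel k n i ↔ dividedDiff i f = 0 := Iff.rfl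

theorem dividedDiff_mul_of_mem {i : ℕ} (f : OPol k n) {g : OPol k n}
    (hg : g ∈ dividedDiffKernel k n i) : dividedDiff i (f * g) = dividedDiff i f * g := by
  by_cases h : i + 1 < n
  · rw [dividedDiff_mul h, mem_dividedDiffKernel.1 hg, mul_zero, add_zero]
  · rw [dividedDiff_of_le (not_lt.1 h), LinearMap.zero_apply, LinearMap.zero_apply, zero_mul]

theorem dividedDiffDesc_mul_of_mem (m : ℕ) (f : OPol k n) {g : OPol k n}
    (hg : ∀ i, g ∈ dividedDiffKernel k n i) :
    dividedDiffDesc m (f * g) = dividedDiffDesc m f * g := by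
  induction m with
  | zero => rfl
  | succ m ih =>
    rw [dividedDiffDesc, LinearMap.comp_apply, ih, dividedDiff_mul_of_mem _ (hg m)]; rfl

theorem dividedDiffStair_mul_of_mem (m : ℕ) (f : OPol k n) {g : OPol k n}
    (hg : ∀ i, g ∈ dividedDiffKernel k n i) :
    dividedDiffStair m (f * g) = dividedDiffStair m f * g := by
  induction m generalizing f with
  | zero => rfl
  | succ m ih =>
    rw [dividedDiffStair, LinearMap.comp_apply, dividedDiffDesc_mul_of_mem m f hg, ih]; rfl

theorem xTwist_eq (i : Fin n) : (xTwist i : OPol k n) = (-1 : k) ^ (i : ℕ) • x i := by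
  simp [xTwist, theta]

theorem xTwist_mul_xTwist {i j : Fin n} (h : i ≠ j) :
    (xTwist i * xTwist j : OPol k n) = -(xTwist j * xTwist i) := by
  rw [xTwist, xTwist, ← map_mul, x_mul_x h, map_neg, map_mul]

theorem xTwist_mem_dividedDiffKernel {i : ℕ} {j : Fin n} (h1 : (j : ℕ) ≠ i)
    (h2 : (j : ℕ) ≠ i + 1) : xTwist j ∈ dividedDiffKernel k n i := by
  rw [mem_dividedDiffKernel, xTwist_eq, map_smul]
  by_cases h : i + 1 < n
  · rw [dividedDiff_x h, if_neg (by simp [h1, h2]), smul_zero]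
  · rw [dividedDiff_of_le (not_lt.1 h), LinearMap.zero_apply, smul_zero]

/-- The purpose of the twist: `∂_i` is 1 on both untwisted variables, so only opposite signs cancel.
-/
theorem xTwist_add_mem_dividedDiffKernel {i : ℕ} (h : i + 1 < n) :
    xTwist ⟨i, Nat.lt_of_succ_lt h⟩ + xTwist ⟨i + 1, h⟩ ∈ dividedDiffKernel k n i := by
  rw [mem_dividedDiffKernel, xTwist_eq, xTwist_eq, map_add, map_smul, map_smul, dividedDiff_x h,
    dividedDiff_x h, if_pos (Or.inl rfl), if_pos (Or.inr rfl), pow_succ, mul_neg_one, neg_smul,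
    add_neg_cancel]

theorem xTwist_mul_mem_dividedDiffKernel {i : ℕ} (h : i + 1 < n) :
    xTwist ⟨i, Nat.lt_of_succ_lt h⟩ * xTwist ⟨i + 1, h⟩ ∈ dividedDiffKernel k n i := by
  rw [mem_dividedDiffKernel, xTwist_eq, xTwist_eq, smul_mul_smul_comm, map_smul,
    dividedDiff_of_lt h, dividedDiffSwap_x_mul, ← mul_one (x ⟨i + 1, h⟩), dividedDiffSwap_x_mul,
    dividedDiffSwap_one]
  simp

end NilHecke

end OPol

namespace OPol

/-! ### Odd Schur polynomials are odd symmetric -/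

section Membership

variable {k : Type*} [CommRing k] {n : ℕ}

theorem listEsymm_xTwist_mem_dividedDiffKernel (r i : ℕ) :
    listEsymm r (List.ofFn xTwist) ∈ dividedDiffKernel k n i := by
  by_cases h : i + 1 < n
  · exact listEsymm_ofFn_mem_of_adjacent (S := (dividedDiffKernel k n i).toSubring) _ h
      (fun j h1 h2 => xTwist_mem_dividedDiffKernel h1 h2)
      (xTwist_add_mem_dividedDiffKernel h) (xTwist_mul_mem_dividedDiffKernel h) r
  · rw [mem_dividedDiffKernel, dividedDiff_of_le (not_lt.1 h), LinearMap.zero_apply]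

theorem listSymmAlgebra_xTwist_le_dividedDiffKernel (i : ℕ) :
    listSymmAlgebra k (List.ofFn xTwist) ≤ dividedDiffKernel k n i :=
  Algebra.adjoin_le (by rintro _ ⟨r, rfl⟩; exact listEsymm_xTwist_mem_dividedDiffKernel r i)

variable (k n) in
/-- The skew polynomials of degree at most `m`. -/
def degreeLE (m : ℕ) : Submodule k (OPol k n) := (1 ⊔ Submodule.span k (Set.range x)) ^ m

theorem x_mul_mem_degreeLE {m : ℕ} {f : OPol k n} (hf : f ∈ degreeLE k n m) (i : Fin n) :
    x i * f ∈ degreeLE k n (m + 1) := by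
  rw [degreeLE, pow_succ']
  exact Submodule.mul_mem_mul
    (Submodule.mem_sup_right (Submodule.subset_span (Set.mem_range_self i))) hf

theorem degreeLE_le_succ (m : ℕ) : degreeLE k n m ≤ degreeLE k n (m + 1) :=
  pow_le_pow_right₀ le_sup_left m.le_succ

theorem dividedDiffSwap_mem_degreeLE (a b : Fin n) {m : ℕ} {f : OPol k n}
    (hf : f ∈ degreeLE k n (m + 1)) : dividedDiffSwap a b f ∈ degreeLE k n m := by
  -- The condition on `x i * dividedDiffSwap a b g` records that the degree drops, without writing
  -- `m - 1` at `m = 0`.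
  have step : ∀ m, (∀ g ∈ degreeLE k n m, dividedDiffSwap a b g ∈ degreeLE k n m ∧
      ∀ i, x i * dividedDiffSwap a b g ∈ degreeLE k n m) →
      ∀ g ∈ degreeLE k n (m + 1), dividedDiffSwap a b g ∈ degreeLE k n m := by
    intro m hm g hg
    rw [degreeLE, pow_succ'] at hg
    induction hg using Submodule.mul_induction_on' with
    | mem_mul_mem v hv g hg =>
      obtain ⟨c, hc, w, hw, rfl⟩ := Submodule.mem_sup.1 hv
      clear hv
      obtain ⟨c, rfl⟩ := Submodule.mem_one.1 hc
      rw [add_mul, map_add, ← Algebra.smul_def, map_smul]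
      refine Submodule.add_mem _ (Submodule.smul_mem _ _ (hm g hg).1) ?_
      induction hw using Submodule.span_induction with
      | mem v hv =>
        obtain ⟨i, rfl⟩ := hv
        rw [dividedDiffSwap_x_mul]
        refine Submodule.sub_mem _ ?_ ((hm g hg).2 _)
        split_ifs
        · exact hg
        · exact Submodule.zero_mem _
      | zero => rw [zero_mul, map_zero]; exact Submodule.zero_mem _
      | add v w _ _ h1 h2 => rw [add_mul, map_add]; exact Submodule.add_mem _ h1 h2
      | smul c v _ h => rw [smul_mul_assoc, map_smul]; exact Submodule.smul_mem _ _ h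
    | add g _ h _ h1 h2 => rw [map_add]; exact Submodule.add_mem _ h1 h2
  refine step m ?_ f hf
  clear hf
  induction m with
  | zero =>
    intro g hg
    rw [degreeLE, pow_zero] at hg
    obtain ⟨c, rfl⟩ := Submodule.mem_one.1 hg
    rw [Algebra.algebraMap_eq_smul_one, map_smul, dividedDiffSwap_one, smul_zero]
    simp
  | succ m ih =>
    intro g hg
    have h := step m ih g hg
    exact ⟨degreeLE_le_succ m h, fun i => x_mul_mem_degreeLE h i⟩

theorem dividedDiff_mem_degreeLE (i : ℕ) {m : ℕ} {f : OPol k n}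
    (hf : f ∈ degreeLE k n (m + 1)) : dividedDiff i f ∈ degreeLE k n m := by
  by_cases h : i + 1 < n
  · rw [dividedDiff_of_lt h]; exact dividedDiffSwap_mem_degreeLE _ _ hf
  · rw [dividedDiff_of_le (not_lt.1 h)]; exact Submodule.zero_mem _

theorem dividedDiffDesc_mem_degreeLE {m e : ℕ} {f : OPol k n} (hf : f ∈ degreeLE k n (e + m)) :
    dividedDiffDesc m f ∈ degreeLE k n e := by
  induction m generalizing e with
  | zero => exact hf
  | succ m ih =>
    exact dividedDiff_mem_degreeLE m (ih (by rwa [add_assoc, add_comm 1]))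

theorem dividedDiffStair_mem_degreeLE {m e : ℕ} {f : OPol k n}
    (hf : f ∈ degreeLE k n (e + ∑ j ∈ range m, j)) : dividedDiffStair m f ∈ degreeLE k n e := by
  induction m generalizing f with
  | zero => exact hf
  | succ m ih =>
    rw [sum_range_succ, ← add_assoc] at hf
    exact ih (dividedDiffDesc_mem_degreeLE hf)

/-- The product contains 1 and is stable under left multiplication by every variable, hence is
everything. -/
theorem mem_staircaseSpan_mul_listSymmAlgebra (f : OPol k n) :
    f ∈ staircaseSpan k (List.ofFn (xTwist (k := k))) *
      (listSymmAlgebra k (List.ofFn (xTwist (k := k) (n := n)))).toSubmodule := by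
  have hpair : (List.ofFn (xTwist (k := k) (n := n))).Pairwise fun a b => a * b = -(b * a) := by
    rw [List.pairwise_ofFn]
    exact fun i j hij => xTwist_mul_xTwist hij.ne
  set W := staircaseSpan k (List.ofFn (xTwist (k := k))) *
      (listSymmAlgebra k (List.ofFn (xTwist (k := k) (n := n)))).toSubmodule
  have htop : f ∈ leftStabilizer W := by
    induction f using induction_on with
    | hc c => exact (leftStabilizer W).algebraMap_mem c
    | hx i =>
      have hmem : (xTwist i : OPol k n) ∈ List.ofFn (xTwist (k := k) (n := n)) :=
        (List.mem_ofFn' _ _).2 (Set.mem_range_self i)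
      have h := mem_leftStabilizer_staircaseSpan (k := k) hpair hmem
      have hx : (x i : OPol k n) = (-1 : k) ^ (i : ℕ) • xTwist i := by
        rw [xTwist_eq, smul_smul, ← mul_pow, neg_one_mul, neg_neg, one_pow, one_smul]
      rw [hx]
      exact (leftStabilizer W).smul_mem h _
    | hmul f g hf hg => exact (leftStabilizer W).mul_mem hf hg
    | hadd f g hf hg => exact (leftStabilizer W).add_mem hf hg
  have h1 : (1 : OPol k n) ∈ W := by
    rw [← mul_one (1 : OPol k n)]
    exact Submodule.mul_mem_mul (Submodule.one_le.1 (one_le_staircaseSpan _))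
      (listSymmAlgebra k (List.ofFn xTwist)).one_mem
  simpa using htop 1 h1

/-- The symmetric factor comes out on the right, and degree counting leaves only a scalar from the
staircase factor. -/
theorem dividedDiffLongest_mem_listSymmAlgebra (f : OPol k n) :
    dividedDiffLongest f ∈ listSymmAlgebra k (List.ofFn (xTwist (k := k) (n := n))) := by
  have hf := mem_staircaseSpan_mul_listSymmAlgebra f
  induction hf using Submodule.mul_induction_on' with
  | mem_mul_mem u hu c hc =>
    rw [dividedDiffLongest, dividedDiffStair_mul_of_mem _ _
      fun i => listSymmAlgebra_xTwist_le_dividedDiffKernel i hc]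
    refine Subalgebra.mul_mem _ ?_ hc
    have hu' : u ∈ degreeLE k n (0 + ∑ j ∈ range n, j) := by
      have := staircaseSpan_le (V := Submodule.span k (Set.range x))
        (L := List.ofFn (xTwist (k := k) (n := n))) (fun a ha => by
          obtain ⟨i, rfl⟩ := (List.mem_ofFn' _ _).1 ha
          rw [xTwist_eq]
          exact Submodule.smul_mem _ _ (Submodule.subset_span (Set.mem_range_self i))) hu
      rwa [List.length_ofFn, ← zero_add (∑ j ∈ range n, j)] at this
    have h0 := dividedDiffStair_mem_degreeLE hu'
    rw [degreeLE, pow_zero] at h0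
    obtain ⟨c, hc⟩ := Submodule.mem_one.1 h0
    rw [← hc]
    exact Subalgebra.algebraMap_mem _ c
  | add f _ g _ h1 h2 => rw [map_add]; exact Subalgebra.add_mem _ h1 h2

theorem elemSymm_eq_listEsymm (r : ℕ) : elemSymm k n r = listEsymm r (List.ofFn x) := by
  rw [elemSymm, ← List.toFinset_finRange,
    sum_powersetCard_sort_prod _ _ (List.pairwise_lt_finRange n), List.ofFn_eq_map]

theorem theta_theta (f : OPol k n) : theta (theta f) = f := by
  refine DFunLike.congr_fun (f := theta.comp theta) (g := AlgHom.id k (OPol k n)) ?_ f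
  ext i
  simp [theta, smul_smul, ← mul_pow]

theorem w0_theta_xTwist (i : Fin n) : w0 (theta (xTwist i : OPol k n)) = x i.rev := by
  simp [xTwist, theta_theta, w0, permAct]

theorem w0_theta_listEsymm_xTwist (r : ℕ) :
    w0 (theta (listEsymm r (List.ofFn xTwist) : OPol k n)) =
      (-1) ^ (∑ j ∈ range r, j) * elemSymm k n r := by
  have h := map_listEsymm ((w0 (k := k) (n := n)).comp theta : OPol k n →+* OPol k n) r
    (List.ofFn xTwist)
  have hrev : (List.ofFn xTwist).map ((w0 (k := k) (n := n)).comp theta : OPol k n →+* OPol k n) =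
      (List.ofFn x).reverse := by
    refine List.ext_getElem (by simp) fun i h1 h2 => ?_
    rw [List.getElem_map, List.getElem_ofFn, List.getElem_reverse, List.getElem_ofFn]
    refine (w0_theta_xTwist _).trans (congrArg x (Fin.ext ?_))
    simp only [List.length_map, List.length_ofFn] at h1
    simp only [Fin.val_rev, List.length_ofFn]
    omega
  rw [hrev, listEsymm_reverse, ← elemSymm_eq_listEsymm] at h
  · exact h
  · rw [List.pairwise_ofFn]
    exact fun i j hij => x_mul_x hij.ne

theorem schur_mem_oddSymm (lam : Fin n → ℕ) : schur k lam ∈ oddSymm k n := by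
  have h : listSymmAlgebra k (List.ofFn xTwist) ≤
      (oddSymm k n).comap ((w0 (k := k) (n := n)).comp theta) := by
    refine Algebra.adjoin_le ?_
    rintro _ ⟨r, rfl⟩
    change w0 (theta _) ∈ oddSymm k n
    rw [w0_theta_listEsymm_xTwist]
    exact Subalgebra.mul_mem _ (Subalgebra.pow_mem _ (Subalgebra.neg_mem _ (Subalgebra.one_mem _)) _)
      (Algebra.subset_adjoin ⟨r, rfl⟩)
  exact h (dividedDiffLongest_mem_listSymmAlgebra _)

end Membership

end OPol

namespace OPol

/-! ### Left multiplication by the sum of the twisted variables -/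

section LeftLinearForms

variable {k : Type*} [CommRing k] {n : ℕ}

/-- The linear form with given coefficients. -/
def linForm (c : Fin n → k) : OPol k n := ∑ i, c i • x i

theorem dividedDiff_linForm_mul {i : ℕ} (hi : i + 1 < n) (c : Fin n → k) (f : OPol k n) :
    dividedDiff i (linForm c * f) = (c ⟨i, Nat.lt_of_succ_lt hi⟩ + c ⟨i + 1, hi⟩) • f -
      linForm (fun j => c (Equiv.swap ⟨i, Nat.lt_of_succ_lt hi⟩ ⟨i + 1, hi⟩ j)) *
        dividedDiff i f := by
  have hne : (⟨i, Nat.lt_of_succ_lt hi⟩ : Fin n) ≠ ⟨i + 1, hi⟩ := by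
    simp only [ne_eq, Fin.mk.injEq]; omega
  rw [dividedDiff_of_lt hi]
  set a : Fin n := ⟨i, Nat.lt_of_succ_lt hi⟩
  set b : Fin n := ⟨i + 1, hi⟩
  simp only [linForm, sum_mul, map_sum, smul_mul_assoc, map_smul, dividedDiffSwap_x_mul, smul_sub,
    sum_sub_distrib]
  congr 1
  · have : ∀ j : Fin n, (c j • if j = a ∨ j = b then f else 0) =
        (if j = a then c j • f else 0) + if j = b then c j • f else 0 := by
      intro j
      by_cases ha : j = a
      · subst ha; simp [hne]
      · by_cases hb : j = b <;> simp [ha, hb, hne.symm]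
    simp only [this, sum_add_distrib, sum_ite_eq', mem_univ, if_true, add_smul]
  · refine (Equiv.sum_comp (Equiv.swap a b) _).symm.trans (sum_congr rfl fun j _ => ?_)
    rw [Equiv.swap_apply_self]

/-- The span of the images of the first `j - 1` divided difference operators. -/
def dividedDiffImages (k : Type*) [CommRing k] (n j : ℕ) : Submodule k (OPol k n) :=
  Submodule.span k {f | ∃ i g, i + 1 < j ∧ f = dividedDiff i g}

theorem dividedDiff_mem_dividedDiffImages {i j : ℕ} (h : i + 1 < j) (g : OPol k n) :
    dividedDiff i g ∈ dividedDiffImages k n j :=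
  Submodule.subset_span ⟨i, g, h, rfl⟩

theorem dividedDiff_mem_dividedDiffImages_succ {j : ℕ} {f : OPol k n}
    (hf : f ∈ dividedDiffImages k n j) : dividedDiff j f ∈ dividedDiffImages k n (j + 1) := by
  induction hf using Submodule.span_induction with
  | mem f hf =>
    obtain ⟨i, g, hi, rfl⟩ := hf
    rw [dividedDiff_anticomm hi]
    exact Submodule.neg_mem _ (dividedDiff_mem_dividedDiffImages (by omega) _)
  | zero => rw [map_zero]; exact Submodule.zero_mem _
  | add f g _ _ h1 h2 => rw [map_add]; exact Submodule.add_mem _ h1 h2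
  | smul c f _ h => rw [map_smul]; exact Submodule.smul_mem _ c h

/-- Allows the descending block to be computed modulo these images. -/
theorem dividedDiffStair_of_mem_dividedDiffImages {m : ℕ} {f : OPol k n}
    (hf : f ∈ dividedDiffImages k n m) : dividedDiffStair m f = 0 := by
  induction hf using Submodule.span_induction with
  | mem f hf =>
    obtain ⟨i, g, hi, rfl⟩ := hf
    exact dividedDiffStair_dividedDiff hi g
  | zero => rw [map_zero]
  | add f g _ _ h1 h2 => rw [map_add, h1, h2, add_zero]
  | smul c f _ h => rw [map_smul, h, smul_zero]

/-- The coefficients of `x_0 - x_1 + ⋯ ± x_m` after applying, up to sign, the permutation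
`s_{j-1} ⋯ s_0`. -/
def shiftedSign (k : Type*) [CommRing k] (n m j : ℕ) (i : Fin n) : k :=
  if (i : ℕ) < j then -(-1) ^ (i : ℕ) else if (i : ℕ) = j then 1 else
    if (i : ℕ) ≤ m then (-1) ^ (i : ℕ) else 0

theorem shiftedSign_swap {m j : ℕ} (hj : j + 1 ≤ m) (hn : j + 1 < n) (i : Fin n) :
    shiftedSign k n m j (Equiv.swap ⟨j, Nat.lt_of_succ_lt hn⟩ ⟨j + 1, hn⟩ i) =
      shiftedSign k n m (j + 1) i := by
  by_cases h1 : i = ⟨j, Nat.lt_of_succ_lt hn⟩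
  · subst h1
    rw [Equiv.swap_apply_left]
    simp [shiftedSign, hj, pow_succ]
  by_cases h2 : i = ⟨j + 1, hn⟩
  · subst h2
    rw [Equiv.swap_apply_right]
    simp [shiftedSign]
  rw [Equiv.swap_apply_of_ne_of_ne h1 h2]
  rw [Fin.ext_iff] at h1 h2
  simp only [shiftedSign] at *
  by_cases h3 : (i : ℕ) < j
  · rw [if_pos h3, if_pos (by omega)]
  · rw [if_neg h3, if_neg h1, if_neg (show ¬ (i : ℕ) < j + 1 by omega), if_neg h2]

/-- By the Leibniz rule each divided difference permutes the coefficients, changes the sign and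
leaves an error term; the error terms all lie in the images to be killed. -/
theorem dividedDiffDesc_linForm_mul {m j : ℕ} (hj : j ≤ m) (hm : m < n) (f : OPol k n) :
    dividedDiffDesc j (linForm (shiftedSign k n m 0) * f) -
      (-1 : k) ^ j • (linForm (shiftedSign k n m j) * dividedDiffDesc j f) ∈
        dividedDiffImages k n j := by
  induction j with
  | zero => simp [dividedDiffDesc]
  | succ j ih =>
    have h := dividedDiff_mem_dividedDiffImages_succ (ih (by omega))
    have hn : j + 1 < n := by omega
    rw [map_sub, map_smul, dividedDiff_linForm_mul hn, smul_sub] at h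
    simp only [shiftedSign_swap hj hn] at h
    set s := shiftedSign k n m j ⟨j, Nat.lt_of_succ_lt hn⟩ + shiftedSign k n m j ⟨j + 1, hn⟩
      with hs
    -- At `j = 0` the two coefficients are 1 and -1 and the error vanishes; later `dividedDiffDesc j
    -- f` is itself a value of `∂_{j-1}`.
    have h2 : s • dividedDiffDesc j f ∈ dividedDiffImages k n (j + 1) := by
      cases j with
      | zero =>
        have : s = 0 := by rw [hs]; simp [shiftedSign, hj]
        rw [this, zero_smul]
        exact Submodule.zero_mem _
      | succ j =>
        exact Submodule.smul_mem _ _ (dividedDiff_mem_dividedDiffImages (by omega) _)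
    have h3 := Submodule.add_mem _ h (Submodule.smul_mem _ ((-1 : k) ^ j) h2)
    convert h3 using 1
    simp only [dividedDiffDesc, LinearMap.comp_apply, pow_succ, mul_neg_one, neg_smul]
    abel

theorem dividedDiff_x_mul_of_ne {i : ℕ} {j : Fin n} (h1 : (j : ℕ) ≠ i) (h2 : (j : ℕ) ≠ i + 1)
    (f : OPol k n) : dividedDiff i (x j * f) = -(x j * dividedDiff i f) := by
  by_cases h : i + 1 < n
  · rw [dividedDiff_of_lt h, dividedDiffSwap_x_mul, if_neg, Equiv.swap_apply_of_ne_of_ne, zero_sub]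
    · simpa [Fin.ext_iff] using h1
    · simpa [Fin.ext_iff] using h2
    · simp [Fin.ext_iff, h1, h2]
  · simp [dividedDiff_of_le (not_lt.1 h)]

theorem dividedDiffDesc_x_mul_of_lt {m : ℕ} {j : Fin n} (h : m < j) (f : OPol k n) :
    dividedDiffDesc m (x j * f) = (-1 : k) ^ m • (x j * dividedDiffDesc m f) := by
  induction m with
  | zero => simp [dividedDiffDesc]
  | succ m ih =>
    rw [dividedDiffDesc, LinearMap.comp_apply, ih (by omega), map_smul,
      dividedDiff_x_mul_of_ne (by omega) (by omega), pow_succ, mul_neg_one, neg_smul, smul_neg]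
    rfl

theorem dividedDiffStair_x_mul_of_le {m : ℕ} {j : Fin n} (h : m ≤ j) (f : OPol k n) :
    dividedDiffStair m (x j * f) = (-1 : k) ^ (∑ i ∈ range m, i) • (x j * dividedDiffStair m f) := by
  induction m generalizing f with
  | zero => simp [dividedDiffStair]
  | succ m ih =>
    rw [dividedDiffStair, LinearMap.comp_apply, dividedDiffDesc_x_mul_of_lt (by omega), map_smul,
      ih (by omega), smul_smul, ← pow_add, sum_range_succ, add_comm]
    rfl

variable (k n) in
/-- The alternating sum of the first `m` variables. -/
def alternatingSum (m : ℕ) : OPol k n :=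
  linForm fun i => if (i : ℕ) < m then (-1) ^ (i : ℕ) else 0

theorem linForm_shiftedSign_zero (m : ℕ) :
    linForm (shiftedSign k n m 0) = alternatingSum k n (m + 1) := by
  refine congrArg linForm (funext fun i => ?_)
  simp only [shiftedSign, Nat.not_lt_zero, if_false, Nat.lt_succ_iff]
  by_cases h : (i : ℕ) = 0
  · simp [h]
  · rw [if_neg h]

theorem linForm_shiftedSign_self {m : ℕ} (hm : m < n) :
    linForm (shiftedSign k n m m) = x ⟨m, hm⟩ - alternatingSum k n m := by
  rw [alternatingSum, linForm, linForm, ← one_smul k (x ⟨m, hm⟩),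
    ← Fintype.sum_ite_eq' (⟨m, hm⟩ : Fin n) (fun i => (1 : k) • (x i : OPol k n)), ← sum_sub_distrib]
  refine sum_congr rfl fun i _ => ?_
  simp only [shiftedSign, Fin.ext_iff]
  by_cases h1 : (i : ℕ) < m
  · simp [h1, h1.ne]
  · by_cases h2 : (i : ℕ) = m
    · simp [h2]
    · simp [h1, h2, show ¬ (i : ℕ) ≤ m by omega]

theorem alternatingSum_succ {m : ℕ} (hm : m < n) :
    alternatingSum k n (m + 1) = alternatingSum k n m + (-1 : k) ^ m • x ⟨m, hm⟩ := by
  rw [alternatingSum, alternatingSum, linForm, linForm,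
    ← Fintype.sum_ite_eq' (⟨m, hm⟩ : Fin n) (fun i => (-1 : k) ^ m • (x i : OPol k n)),
    ← sum_add_distrib]
  refine sum_congr rfl fun i _ => ?_
  simp only [Fin.ext_iff]
  by_cases h1 : (i : ℕ) < m
  · simp [h1, h1.ne, Nat.lt_succ_of_lt h1]
  · by_cases h2 : (i : ℕ) = m
    · simp [h2]
    · simp [h1, h2, show ¬ (i : ℕ) < m + 1 by omega]

/-- Write `A_m` for the alternating sum. Modulo terms killed by the remaining blocks, the descending
block turns `A_{m+1}` into `±(x_m - A_m)`. With `s = m(m-1)/2`, those blocks then give `x_m` the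
sign `(-1)^s` and, by induction, `A_m` the sign `(-1)^{s+m+1}`; the combination is again a multiple
of `A_m + (-1)^m x_m = A_{m+1}`. -/
theorem dividedDiffStair_alternatingSum_mul {m : ℕ} (hm : m ≤ n) (f : OPol k n) :
    dividedDiffStair m (alternatingSum k n m * f) =
      (-1 : k) ^ (∑ i ∈ range m, i + m + 1) • (alternatingSum k n m * dividedDiffStair m f) := by
  induction m generalizing f with
  | zero => simp [alternatingSum, linForm]
  | succ m ih =>
    have h := dividedDiffStair_of_mem_dividedDiffImages
      (dividedDiffDesc_linForm_mul (le_refl m) hm f)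
    rw [map_sub, sub_eq_zero, linForm_shiftedSign_zero, linForm_shiftedSign_self hm, map_smul,
      sub_mul, map_sub, dividedDiffStair_x_mul_of_le (j := ⟨m, hm⟩) le_rfl, ih (by omega)] at h
    rw [dividedDiffStair, LinearMap.comp_apply, LinearMap.comp_apply, h, alternatingSum_succ hm,
      add_mul, smul_mul_assoc, smul_add, smul_smul, smul_sub, smul_smul, smul_smul, sum_range_succ]
    set s := ∑ i ∈ range m, i
    have h1 : (-1 : k) ^ (s + m + (m + 1) + 1) * (-1) ^ m = (-1) ^ m * (-1) ^ s := by
      rw [← pow_add, ← pow_add, show s + m + (m + 1) + 1 + m = m + s + 2 * (m + 1) by ring,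
        pow_add _ (m + s), pow_mul _ 2, neg_one_sq, one_pow, mul_one]
    have h2 : (-1 : k) ^ (s + m + (m + 1) + 1) = -((-1) ^ m * (-1) ^ (s + m + 1)) := by
      rw [← pow_add, show s + m + (m + 1) + 1 = m + (s + m + 1) + 1 by ring, pow_succ, mul_neg_one]
    rw [h1, h2, neg_smul]
    abel

theorem alternatingSum_self : alternatingSum k n n = ∑ i, xTwist i := by
  simp [alternatingSum, linForm, xTwist_eq]

theorem dividedDiffLongest_sum_xTwist_mul (f : OPol k n) :
    dividedDiffLongest ((∑ i, xTwist i) * f) =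
      (-1 : k) ^ (∑ i ∈ range n, i + n + 1) • ((∑ i, xTwist i) * dividedDiffLongest f) := by
  rw [← alternatingSum_self]
  exact dividedDiffStair_alternatingSum_mul le_rfl f

theorem dividedDiffLongest_mul_sum_xTwist (f : OPol k n) :
    dividedDiffLongest (f * ∑ i, xTwist i) = dividedDiffLongest f * ∑ i, xTwist i := by
  refine dividedDiffStair_mul_of_mem n f fun i => ?_
  have h := listEsymm_xTwist_mem_dividedDiffKernel (k := k) (n := n) 1 i
  rwa [listEsymm_one, List.sum_ofFn] at h

end LeftLinearForms

end OPol

namespace OPol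

/-! ### Twice the differential of an odd Schur polynomial -/

section Differential

variable {k : Type*} [CommRing k] {n : ℕ}

theorem parity_x (i : Fin n) : parity (x i : OPol k n) = -x i := by simp [parity]

theorem d_algebraMap (c : k) : d (algebraMap k (OPol k n) c) = 0 := by
  rw [Algebra.algebraMap_eq_smul_one, map_smul, d, skewDer_one, smul_zero]

/-- Twice the differential is the supercommutator with `x_1 + ⋯ + x_n`. -/
theorem two_smul_d (f : OPol k n) :
    (2 : ℤ) • d f = (∑ i, x i) * f - parity f * ∑ i, x i := by
  induction f using induction_on with
  | hc c => rw [d_algebraMap, smul_zero, AlgHom.commutes, Algebra.commutes, sub_self]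
  | hx i =>
    -- On an odd generator the supercommutator is the sum of the `x_j x_i + x_i x_j`; only `j = i`
    -- survives.
    rw [d_x, parity_x, sum_mul, mul_sum, ← sum_sub_distrib, sum_eq_single i]
    · rw [neg_mul, sub_neg_eq_add, two_smul, pow_two]
    · intro j _ hj
      rw [x_mul_x hj]
      noncomm_ring
    · simp
  | hmul f g hf hg =>
    rw [d_mul, smul_add, ← smul_mul_assoc, ← mul_smul_comm, hf, hg, map_mul]
    noncomm_ring
  | hadd f g hf hg =>
    rw [map_add, map_add, smul_add, hf, hg]
    noncomm_ring

theorem neg_one_pow_mul_eq_smul (e : ℕ) (f : OPol k n) : (-1) ^ e * f = (-1 : k) ^ e • f := by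
  rcases neg_one_pow_eq_or k e with h | h <;> rcases Nat.even_or_odd e with h' | h' <;>
    simp [h'.neg_one_pow]

theorem parity_permAct (w : Equiv.Perm (Fin n)) (f : OPol k n) :
    parity (permAct w f) = permAct w (parity f) := by
  refine DFunLike.congr_fun (f := parity.comp (permAct w)) (g := (permAct w).comp parity) ?_ f
  ext i
  simp [parity, permAct]

theorem parity_theta (f : OPol k n) : parity (theta f) = theta (parity f) := by
  refine DFunLike.congr_fun (f := parity.comp theta) (g := theta.comp parity) ?_ f
  ext i
  simp [parity, theta]

theorem parity_dividedDiff (i : ℕ) (f : OPol k n) :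
    parity (dividedDiff i f) = -dividedDiff i (parity f) := by
  by_cases h : i + 1 < n
  · refine LinearMap.congr_fun (f := parity.toLinearMap ∘ₗ dividedDiff i)
      (g := -(dividedDiff i ∘ₗ parity.toLinearMap)) (linearMap_ext_left ?_ fun j f h' => ?_) f
    · simp [dividedDiff_one]
    · simp only [LinearMap.comp_apply, LinearMap.neg_apply, AlgHom.toLinearMap_apply] at h' ⊢
      rw [map_mul parity (x j) f, parity_x, neg_mul, map_neg, neg_neg]
      rw [dividedDiff_of_lt h] at *
      rw [dividedDiffSwap_x_mul, dividedDiffSwap_x_mul, map_sub, map_mul, h', parity_x]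
      split_ifs <;> simp
  · simp [dividedDiff_of_le (not_lt.1 h)]

theorem parity_dividedDiffDesc (m : ℕ) (f : OPol k n) :
    parity (dividedDiffDesc m f) = (-1 : k) ^ m • dividedDiffDesc m (parity f) := by
  induction m with
  | zero => simp [dividedDiffDesc]
  | succ m ih =>
    rw [dividedDiffDesc, LinearMap.comp_apply, parity_dividedDiff, ih, map_smul, pow_succ,
      mul_neg_one, neg_smul]
    rfl

theorem parity_dividedDiffStair (m : ℕ) (f : OPol k n) :
    parity (dividedDiffStair m f) =
      (-1 : k) ^ (∑ i ∈ range m, i) • dividedDiffStair m (parity f) := by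
  induction m generalizing f with
  | zero => simp [dividedDiffStair]
  | succ m ih =>
    rw [dividedDiffStair, LinearMap.comp_apply, ih, parity_dividedDiffDesc, map_smul, smul_smul,
      ← pow_add, sum_range_succ]
    rfl

theorem parity_monTwist (a : Fin n → ℕ) :
    parity (monTwist a : OPol k n) = (-1 : k) ^ (∑ i, a i) • monTwist a := by
  have h : ∀ (l : List (Fin n)),
      parity ((l.map fun i => xTwist i ^ a i).prod : OPol k n) =
        (-1 : k) ^ (l.map a).sum • (l.map fun i => xTwist i ^ a i).prod := by
    intro l
    induction l with
    | nil => simp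
    | cons i l ih =>
      have hi : parity (xTwist i : OPol k n) = (-1 : k) • xTwist i := by
        rw [xTwist, parity_theta, parity_x, map_neg, neg_one_smul]
      rw [List.map_cons, List.prod_cons, map_mul, ih, map_pow, hi, smul_pow, smul_mul_smul_comm,
        List.map_cons, List.sum_cons, pow_add]
  rw [monTwist, List.ofFn_eq_map, h, ← List.ofFn_eq_map, List.sum_ofFn]

theorem sum_delta : ∑ i, delta n i = ∑ i ∈ range n, i := by
  rw [← sum_range_reflect, ← Fin.sum_univ_eq_sum_range]
  rfl

theorem xTwist_mul_monTwist (a : Fin n → ℕ) (i : Fin n) :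
    xTwist i * monTwist a = (-1 : k) ^ sizeAbove a i • (monTwist (addBox a i) : OPol k n) := by
  rw [← neg_one_pow_mul_eq_smul]
  exact mul_prod_ofFn_pow xTwist (fun _ _ h => xTwist_mul_xTwist h) a i

theorem xTwist_mul_monTwist_comm (a : Fin n → ℕ) (i : Fin n) :
    xTwist i * monTwist a = (-1 : k) ^ (a i + ∑ j, a j) • (monTwist a * xTwist i : OPol k n) := by
  rw [← neg_one_pow_mul_eq_smul]
  exact mul_prod_ofFn_pow_comm xTwist (fun _ _ h => xTwist_mul_xTwist h) a i

/-- The kernel of `∂_i` lies in its image: `f = ∂_i(x_i f)` when `∂_i f = 0`. -/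
theorem dividedDiffLongest_of_mem_dividedDiffKernel {i : ℕ} (hi : i + 1 < n) {f : OPol k n}
    (hf : f ∈ dividedDiffKernel k n i) : dividedDiffLongest f = 0 := by
  have h : f = dividedDiff i (x ⟨i, Nat.lt_of_succ_lt hi⟩ * f) := by
    rw [mem_dividedDiffKernel] at hf
    rw [dividedDiff_mul hi, hf, dividedDiff_x hi, if_pos (Or.inl rfl), one_mul, mul_zero, add_zero]
  rw [h]
  exact dividedDiffStair_dividedDiff hi _

theorem dividedDiffLongest_monTwist_of_eq {i : ℕ} (hi : i + 1 < n) {a : Fin n → ℕ}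
    (ha : a ⟨i, Nat.lt_of_succ_lt hi⟩ = a ⟨i + 1, hi⟩) :
    dividedDiffLongest (monTwist a : OPol k n) = 0 := by
  refine dividedDiffLongest_of_mem_dividedDiffKernel hi ?_
  refine prod_ofFn_mem_of_adjacent (S := (dividedDiffKernel k n i).toSubring) _ hi ?_ ?_
  · exact fun j h1 h2 => Subalgebra.pow_mem _ (xTwist_mem_dividedDiffKernel h1 h2) _
  · rw [ha]
    have hanti := xTwist_mul_xTwist (k := k) (n := n) (i := ⟨i, Nat.lt_of_succ_lt hi⟩)
      (j := ⟨i + 1, hi⟩) (by simp [Fin.ext_iff])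
    have hmem := xTwist_mul_mem_dividedDiffKernel (k := k) hi
    generalize (xTwist ⟨i, Nat.lt_of_succ_lt hi⟩ : OPol k n) = y at *
    generalize (xTwist ⟨i + 1, hi⟩ : OPol k n) = z at *
    generalize a ⟨i + 1, hi⟩ = e
    change y ^ e * z ^ e ∈ dividedDiffKernel k n i
    induction e with
    | zero => simp
    | succ e ih =>
      have h := mul_pow_of_anticomm hanti e
      -- Equal exponents make the two-variable factor `±(y z)^e`, and `y z` lies in the kernel.
      have : y ^ (e + 1) * z ^ (e + 1) = (-1) ^ e * (y ^ e * z ^ e * (y * z)) := by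
        rw [pow_succ, pow_succ', mul_assoc, ← mul_assoc y z, mul_assoc (y ^ e) (z ^ e),
          ← mul_assoc (z ^ e) y z]
        have h3 : (-1) ^ e * (y * z ^ e) = z ^ e * y := by
          rw [h, ← mul_assoc, ← pow_add, ← two_mul, pow_mul, neg_one_sq, one_pow, one_mul]
        have h4 : z * z ^ e = z ^ e * z := by rw [← pow_succ, ← pow_succ']
        rw [← h3, mul_assoc, mul_assoc, mul_assoc, h4]
        rcases neg_one_pow_eq_or (OPol k n) e with h5 | h5 <;> simp [h5]
      rw [this]
      exact Subalgebra.mul_mem _ (Subalgebra.pow_mem _ (Subalgebra.neg_mem _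
        (Subalgebra.one_mem _)) _) (Subalgebra.mul_mem _ ih hmem)

/-- A box cannot be added only below a row of equal length. Since `δ` drops by one there, the
exponents of `x̃^δ x̃^μ` agree in the two rows. -/
theorem schur_addBox_of_not_antitone {lam : Fin n → ℕ} (hlam : Antitone lam) {i : Fin n}
    (h : ¬ Antitone (addBox lam i)) : schur k (addBox lam i) = 0 := by
  obtain ⟨j, hj, he⟩ : ∃ j, ∃ hj : j + 1 < n, (⟨j + 1, hj⟩ : Fin n) = i ∧
      lam ⟨j, Nat.lt_of_succ_lt hj⟩ = lam ⟨j + 1, hj⟩ := by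
    by_contra! hc
    refine h fun p q hpq => ?_
    have hlam' := hlam hpq
    simp only [addBox, Function.update_apply]
    split_ifs with hq hp hp
    · rfl
    · subst hq
      have hlt : (p : ℕ) < q := lt_of_le_of_ne hpq fun e => hp (Fin.ext e)
      have hq1 : (q : ℕ) - 1 + 1 < n := by omega
      have e1 : (⟨(q : ℕ) - 1 + 1, hq1⟩ : Fin n) = q := Fin.ext (by simp; omega)
      have h1 := hc (q - 1) hq1 e1
      rw [e1] at h1
      have h2 : lam q ≤ lam ⟨(q : ℕ) - 1, Nat.lt_of_succ_lt hq1⟩ :=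
        hlam (Fin.le_def.2 (by simp))
      have h3 : lam ⟨(q : ℕ) - 1, Nat.lt_of_succ_lt hq1⟩ ≤ lam p :=
        hlam (Fin.le_def.2 (by simp; omega))
      omega
    · subst hp; omega
    · exact hlam'
  obtain ⟨rfl, he⟩ := he
  obtain ⟨e, hprod⟩ := prod_ofFn_pow_mul_prod_ofFn_pow (xTwist (k := k) (n := n))
    (fun _ _ h => xTwist_mul_xTwist h) (delta n) (addBox lam ⟨j + 1, hj⟩)
  have hzero := dividedDiffLongest_monTwist_of_eq (k := k) hj
    (a := fun l => delta n l + addBox lam ⟨j + 1, hj⟩ l) (by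
      simp only [addBox, Function.update_self, delta]
      rw [Function.update_of_ne (by simp [Fin.ext_iff]), he]
      omega)
  rw [schur, monTwist, monTwist, hprod, neg_one_pow_mul_eq_smul, map_smul]
  rw [monTwist] at hzero
  rw [hzero, smul_zero, map_zero, map_zero]

/-- As `n + 1 + δ_i = 2n - i` for zero-based `i`, the first sign is `(-1)^i`. The signs agree
exactly when the content `λ_i - i` is even. -/
theorem neg_one_pow_sub_eq_parityBracket (lam : Fin n → ℕ) (i : Fin n) :
    (-1 : ℤ) ^ (n + 1 + delta n i) - (-1) ^ lam i =
      2 * ((-1) ^ (i : ℕ) * parityBracket (addedContent lam i)) := by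
  have h1 : (-1 : ℤ) ^ (n + 1 + delta n i) = (-1) ^ (i : ℕ) := by
    have : n + 1 + delta n i + i = 2 * n := by have := i.2; simp only [delta]; omega
    rcases Nat.even_or_odd (i : ℕ) with hi | hi
    · rw [hi.neg_one_pow, Even.neg_one_pow]
      rw [Nat.even_iff] at *; omega
    · rw [hi.neg_one_pow, Odd.neg_one_pow]
      rw [Nat.odd_iff] at *; omega
  rw [h1]
  have h2 : Even (addedContent lam i) ↔ (Even (lam i) ↔ Even (i : ℕ)) := by
    rw [addedContent, add_sub_add_right_eq_sub, Int.even_sub, Int.even_coe_nat, Int.even_coe_nat]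
  rw [parityBracket]
  have h3 : ∀ m : ℕ, (-1 : ℤ) ^ m = if Even m then 1 else -1 := fun m => by
    split_ifs with h
    · exact h.neg_one_pow
    · exact (Nat.not_even_iff_odd.1 h).neg_one_pow
  simp only [h2, h3]
  by_cases hi : Even (i : ℕ) <;> by_cases hl : Even (lam i) <;>
    norm_num [hi, hl, -Nat.not_even_iff_odd]

theorem two_smul_d_schur (lam : Fin n → ℕ) :
    (2 : ℤ) • d (schur k lam) = ∑ i, (2 : ℤ) •
      ((-1 : ℤ) ^ (sizeAbove lam i + (i : ℕ)) * parityBracket (addedContent lam i)) •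
        schur k (addBox lam i) := by
  set S : OPol k n := dividedDiffLongest (monTwist (delta n) * monTwist lam) with hS
  -- Normal form for both products, with `x̃_i` between `x̃^δ` and `x̃^λ`.
  set G : Fin n → OPol k n := fun i =>
    dividedDiffLongest (monTwist (delta n) * (xTwist i * monTwist lam)) with hG
  -- Passing `∂_{w0}` and then `x̃^δ` each produces `(-1)^{n(n-1)/2}`; these cancel.
  have hleft : (∑ i, xTwist i) * S = ∑ i, (-1 : k) ^ (n + 1 + delta n i) • G i := by
    have h := dividedDiffLongest_sum_xTwist_mul (monTwist (delta n) * monTwist lam : OPol k n)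
    rw [← hS] at h
    have h' := congrArg (fun y => (-1 : k) ^ (∑ i ∈ range n, i + n + 1) • y) h
    simp only [smul_smul, ← mul_pow, neg_one_mul, neg_neg, one_pow, one_smul] at h'
    rw [← h', sum_mul, map_sum, smul_sum]
    refine sum_congr rfl fun i _ => ?_
    rw [← mul_assoc, xTwist_mul_monTwist_comm, smul_mul_assoc, map_smul, smul_smul, mul_assoc,
      ← pow_add, sum_delta]
    congr 1
    rw [show ∑ i ∈ range n, i + n + 1 + (delta n i + ∑ i ∈ range n, i) =
      n + 1 + delta n i + 2 * ∑ i ∈ range n, i by ring, pow_add, pow_mul, neg_one_sq, one_pow,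
      mul_one]
  -- `S` has parity `|λ|`, since `∂_{w0}` removes the degree of `x̃^δ`; this sign cancels against
  -- the one from moving `x̃_i` across `x̃^λ`.
  have hright : parity S * (∑ i, xTwist i) = ∑ i, (-1 : k) ^ lam i • G i := by
    have hp : parity S = (-1 : k) ^ (∑ i, lam i) • S := by
      rw [hS, dividedDiffLongest, parity_dividedDiffStair, map_mul, parity_monTwist, parity_monTwist,
        smul_mul_smul_comm, map_smul, smul_smul, sum_delta, ← mul_assoc, ← mul_pow]
      simp
    rw [hp, smul_mul_assoc, hS, ← dividedDiffLongest_mul_sum_xTwist, mul_sum, map_sum, smul_sum]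
    refine sum_congr rfl fun i _ => ?_
    rw [hG]
    simp only
    rw [xTwist_mul_monTwist_comm lam i, mul_smul_comm, map_smul, smul_smul, ← pow_add, mul_assoc,
      ← add_assoc, ← two_mul, pow_add, pow_mul, neg_one_sq, one_pow, one_mul]
  have hx : ∑ i, (x i : OPol k n) = w0 (theta (∑ i, xTwist i)) := by
    rw [map_sum, map_sum, ← Equiv.sum_comp Fin.revPerm]
    exact sum_congr rfl fun i _ => (w0_theta_xTwist i).symm
  have hpar : parity (schur k lam) = w0 (theta (parity S)) := by
    rw [schur, w0, parity_permAct, parity_theta]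
  rw [two_smul_d, hpar, hx, schur, ← hS, ← map_mul, ← map_mul, ← map_mul, ← map_mul, ← map_sub,
    ← map_sub, hleft, hright, ← sum_sub_distrib, map_sum, map_sum]
  refine sum_congr rfl fun i _ => ?_
  have hGi : w0 (theta (G i)) = (-1 : ℤ) ^ sizeAbove lam i • schur k (addBox lam i) := by
    rw [hG]
    simp only
    rw [xTwist_mul_monTwist, mul_smul_comm, map_smul, map_smul, map_smul, schur,
      ← Int.cast_smul_eq_zsmul k]
    push_cast
    rfl
  have hc : (-1 : k) ^ (n + 1 + delta n i) - (-1 : k) ^ lam i =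
      ((2 * ((-1) ^ (i : ℕ) * parityBracket (addedContent lam i)) : ℤ) : k) := by
    rw [← neg_one_pow_sub_eq_parityBracket]
    push_cast
    rfl
  rw [← sub_smul, hc, Int.cast_smul_eq_zsmul, map_zsmul, map_zsmul, hGi, smul_smul, smul_smul]
  congr 1
  rw [pow_add]
  ring

end Differential

/-! ### Absence of 2-torsion over the integers -/

section TorsionFree

variable {k : Type*} [CommRing k] {n : ℕ}

/-- Left multiplication by `x_i` in the coordinates of the ordered monomials. -/
noncomputable def monomialAction (k : Type*) [CommRing k] (i : Fin n) :
    Module.End k ((Fin n → ℕ) →₀ k) :=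
  Finsupp.linearCombination k fun a =>
    Finsupp.single (addBox a i) ((-1 : k) ^ sizeAbove a i)

theorem monomialAction_single (i : Fin n) (a : Fin n → ℕ) (c : k) :
    monomialAction k i (Finsupp.single a c) =
      Finsupp.single (addBox a i) (c * (-1 : k) ^ sizeAbove a i) := by
  simp [monomialAction]

theorem sizeAbove_addBox (a : Fin n → ℕ) (i j : Fin n) :
    sizeAbove (addBox a j) i = sizeAbove a i + if j < i then 1 else 0 := by
  have : ∀ l, addBox a j l = a l + if l = j then 1 else 0 := by
    intro l
    by_cases h : l = j
    · subst h; simp [addBox]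
    · simp [addBox, h]
  simp [sizeAbove, this, sum_add_distrib]

/-- Of the two orders of adding the boxes, exactly one counts the first box in `sizeAbove` of the
second. -/
theorem monomialAction_anticomm {i j : Fin n} (hij : i ≠ j) :
    monomialAction k i * monomialAction k j + monomialAction k j * monomialAction k i = 0 := by
  refine Finsupp.lhom_ext fun a c => ?_
  have hcomm : addBox (addBox a j) i = addBox (addBox a i) j := by
    simp only [addBox, Function.update_of_ne hij, Function.update_of_ne hij.symm]
    exact Function.update_comm hij.symm _ _ _
  rw [LinearMap.add_apply, Module.End.mul_apply, Module.End.mul_apply, monomialAction_single,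
    monomialAction_single, monomialAction_single, monomialAction_single, hcomm, sizeAbove_addBox,
    sizeAbove_addBox, ← Finsupp.single_add, LinearMap.zero_apply, Finsupp.single_eq_zero]
  rcases lt_or_gt_of_ne hij with h | h
  · rw [if_neg h.not_gt, if_pos h]; ring
  · rw [if_pos h, if_neg h.not_gt]; ring

/-- The map from coordinates to skew polynomials. -/
noncomputable def ofCoordinates (k : Type*) [CommRing k] (n : ℕ) :
    ((Fin n → ℕ) →₀ k) →ₗ[k] OPol k n :=
  Finsupp.linearCombination k fun a => (List.ofFn fun i => x i ^ a i).prod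

theorem ofCoordinates_monomialAction (i : Fin n) (m : (Fin n → ℕ) →₀ k) :
    ofCoordinates k n (monomialAction k i m) = x i * ofCoordinates k n m := by
  induction m using Finsupp.induction_linear with
  | zero => simp
  | add f g hf hg => rw [map_add, map_add, map_add, mul_add, hf, hg]
  | single a c =>
    rw [monomialAction_single, ofCoordinates, Finsupp.linearCombination_single,
      Finsupp.linearCombination_single, mul_smul_comm,
      mul_prod_ofFn_pow x (fun _ _ h => x_mul_x h), neg_one_pow_mul_eq_smul, smul_smul]
    rfl

variable (k n) in
/-- The action of skew polynomials on coordinates. -/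
noncomputable def coordinateAction : OPol k n →ₐ[k] Module.End k ((Fin n → ℕ) →₀ k) :=
  lift (monomialAction k) fun _ _ h => monomialAction_anticomm h

theorem ofCoordinates_coordinateAction (f : OPol k n) (m : (Fin n → ℕ) →₀ k) :
    ofCoordinates k n (coordinateAction k n f m) = f * ofCoordinates k n m := by
  induction f using induction_on generalizing m with
  | hc c =>
    rw [AlgHom.commutes, Module.algebraMap_end_apply, map_smul, Algebra.smul_def]
  | hx i => rw [coordinateAction, lift_x, ofCoordinates_monomialAction]
  | hmul f g hf hg => rw [map_mul, Module.End.mul_apply, hf, hg, mul_assoc]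
  | hadd f g hf hg => rw [map_add, LinearMap.add_apply, map_add, hf, hg, add_mul]

theorem ofCoordinates_single_zero : ofCoordinates k n (Finsupp.single 0 1) = 1 := by
  rw [ofCoordinates, Finsupp.linearCombination_single, one_smul]
  simp

/-- Acting on the coordinate vector of 1 embeds skew polynomials in a free module, with
`ofCoordinates` as left inverse, so cancellation takes place there. -/
theorem two_smul_injective {f g : OPol ℤ n} (h : (2 : ℤ) • f = (2 : ℤ) • g) : f = g := by
  have h1 := congrArg (fun y => coordinateAction ℤ n y (Finsupp.single 0 1)) h
  simp only [map_zsmul, LinearMap.smul_apply] at h1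
  have h2 := congrArg (ofCoordinates ℤ n) (smul_right_injective _ (two_ne_zero (α := ℤ)) h1)
  rwa [ofCoordinates_coordinateAction, ofCoordinates_coordinateAction, ofCoordinates_single_zero,
    mul_one, mul_one] at h2

end TorsionFree

/-! ### Transport from the integers to an arbitrary base ring -/

section BaseChange

variable (k : Type*) [CommRing k] {n : ℕ}

/-- The change of scalars from the integers. -/
def baseChange : OPol ℤ n →ₐ[ℤ] OPol k n := lift x fun _ _ h => x_anticomm h

@[simp] theorem baseChange_x (i : Fin n) : baseChange k (x i) = x i := lift_x _ _ i

theorem baseChange_algebraMap (c : ℤ) :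
    baseChange k (algebraMap ℤ (OPol ℤ n) c) = algebraMap k (OPol k n) c := by
  rw [AlgHom.commutes]; simp

theorem baseChange_monomialHom (σ : Equiv.Perm (Fin n)) {c : Fin n → ℤ} {c' : Fin n → k}
    (h : ∀ i, (c i : k) = c' i) (f : OPol ℤ n) :
    baseChange k (monomialHom σ c f) = monomialHom σ c' (baseChange k f) := by
  induction f using induction_on with
  | hc a => rw [AlgHom.commutes, baseChange_algebraMap, AlgHom.commutes]
  | hx i =>
    rw [monomialHom_x, baseChange_x, monomialHom_x, map_smul, baseChange_x, ← h,
      Int.cast_smul_eq_zsmul]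
  | hmul f g hf hg => rw [map_mul, map_mul, map_mul, map_mul, hf, hg]
  | hadd f g hf hg => rw [map_add, map_add, map_add, map_add, hf, hg]

theorem baseChange_parity (f : OPol ℤ n) : baseChange k (parity f) = parity (baseChange k f) :=
  baseChange_monomialHom k _ (by simp) f

theorem baseChange_permAct (w : Equiv.Perm (Fin n)) (f : OPol ℤ n) :
    baseChange k (permAct w f) = permAct w (baseChange k f) :=
  baseChange_monomialHom k _ (by simp) f

theorem baseChange_theta (f : OPol ℤ n) : baseChange k (theta f) = theta (baseChange k f) :=
  baseChange_monomialHom k _ (by simp) f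

theorem baseChange_skewDer {σ : OPol ℤ n →ₐ[ℤ] OPol ℤ n} {v : Fin n → OPol ℤ n}
    {σ' : OPol k n →ₐ[k] OPol k n} {v' : Fin n → OPol k n} {hv hv'}
    (hσ : ∀ f, baseChange k (σ f) = σ' (baseChange k f)) (hvv : ∀ i, baseChange k (v i) = v' i)
    (f : OPol ℤ n) :
    baseChange k (skewDer σ v hv f) = skewDer σ' v' hv' (baseChange k f) := by
  induction f using induction_on with
  | hc a =>
    rw [baseChange_algebraMap, Algebra.algebraMap_eq_smul_one, Algebra.algebraMap_eq_smul_one,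
      map_smul, skewDer_one, smul_zero, map_zero, map_smul, skewDer_one, smul_zero]
  | hx i => rw [skewDer_x, baseChange_x, skewDer_x, hvv]
  | hmul f g hf hg => rw [skewDer_mul, map_add, map_mul, map_mul, map_mul, skewDer_mul, hf, hg, hσ]
  | hadd f g hf hg => rw [map_add, map_add, map_add, map_add, hf, hg]

theorem baseChange_d (f : OPol ℤ n) : baseChange k (d f) = d (baseChange k f) :=
  baseChange_skewDer k (baseChange_parity k) (by simp) f

theorem baseChange_dividedDiff (i : ℕ) (f : OPol ℤ n) :
    baseChange k (dividedDiff i f) = dividedDiff i (baseChange k f) := by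
  by_cases h : i + 1 < n
  · rw [dividedDiff_of_lt h, dividedDiff_of_lt h]
    refine baseChange_skewDer k (fun f => ?_) (fun j => ?_) f
    · rw [AlgHom.comp_apply, AlgHom.comp_apply, baseChange_permAct, baseChange_parity]
    · split_ifs <;> simp
  · simp [dividedDiff_of_le (not_lt.1 h)]

theorem baseChange_dividedDiffDesc (m : ℕ) (f : OPol ℤ n) :
    baseChange k (dividedDiffDesc m f) = dividedDiffDesc m (baseChange k f) := by
  induction m with
  | zero => rfl
  | succ m ih => rw [dividedDiffDesc, LinearMap.comp_apply, baseChange_dividedDiff, ih]; rfl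

theorem baseChange_dividedDiffStair (m : ℕ) (f : OPol ℤ n) :
    baseChange k (dividedDiffStair m f) = dividedDiffStair m (baseChange k f) := by
  induction m generalizing f with
  | zero => rfl
  | succ m ih => rw [dividedDiffStair, LinearMap.comp_apply, ih, baseChange_dividedDiffDesc]; rfl

theorem baseChange_monTwist (a : Fin n → ℕ) : baseChange k (monTwist a) = monTwist a := by
  rw [monTwist, map_list_prod, List.map_ofFn, monTwist]
  refine congrArg List.prod (congrArg List.ofFn (funext fun i => ?_))
  rw [Function.comp_apply, map_pow, xTwist, baseChange_theta, baseChange_x, xTwist]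

theorem baseChange_schur (lam : Fin n → ℕ) : baseChange k (schur ℤ lam) = schur k lam := by
  rw [schur, w0, baseChange_permAct, baseChange_theta, dividedDiffLongest,
    baseChange_dividedDiffStair, map_mul, baseChange_monTwist, baseChange_monTwist]
  rfl

/-- Halving is legitimate over the integers, and `d` and the Schur polynomials are compatible with
base change. At this stage the tuple is arbitrary and all rows are summed. -/
theorem d_schur (lam : Fin n → ℕ) :
    d (schur k lam) = ∑ i,
      ((-1 : ℤ) ^ (sizeAbove lam i + (i : ℕ)) * parityBracket (addedContent lam i)) •
        schur k (addBox lam i) := by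
  have h : d (schur ℤ lam) = ∑ i,
      ((-1 : ℤ) ^ (sizeAbove lam i + (i : ℕ)) * parityBracket (addedContent lam i)) •
        schur ℤ (addBox lam i) :=
    two_smul_injective (by rw [two_smul_d_schur, smul_sum])
  rw [← baseChange_schur, ← baseChange_d, h, map_sum]
  exact sum_congr rfl fun i _ => by rw [map_zsmul, baseChange_schur]

end BaseChange

end OPol

open Classical in
theorem mainTheorem8 {k : Type*} [CommRing k] (n : ℕ) (lam : Fin n → ℕ) (hlam : Antitone lam) :
    OPol.schur k lam ∈ OPol.oddSymm k n ∧
    OPol.d (OPol.schur k lam) =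
      ∑ i ∈ Finset.univ.filter (fun i : Fin n => Antitone (addBox lam i)),
        ((-1 : ℤ) ^ (sizeAbove lam i + (i : ℕ)) * parityBracket (addedContent lam i)) •
          OPol.schur k (addBox lam i) := by
  refine ⟨OPol.schur_mem_oddSymm lam, ?_⟩
  rw [OPol.d_schur, Finset.sum_filter]
  refine Finset.sum_congr rfl fun i _ => ?_
  split_ifs with h
  · rfl
  · rw [OPol.schur_addBox_of_not_antitone hlam h, smul_zero]
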